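/- For $\alpha\in\mathbb C$ and $|z|<1$ let $\mathrm{Li}_\alpha(z)=\sum_{n\ge1}z^n/n^\alpha$, and let $C_\alpha=e^{\pi i(-\alpha-1)}\Gamma(1-\alpha)$. For $q\in\mathbb C\setminus[0,\infty)$ let $q^{s}$ denote the branch with $0<\arg q<2\pi$ (in (a), where $q>0$, the power is the usual one). Let $X$ be the universal cover of $\mathbb C\setminus\{0,1\}$ with base point $1/2$, i.e. the set of homotopy classes $[c]$ of paths $c$ in $\mathbb C\setminus\{0,1\}$ starting at $1/2$. A multivalued analytic function on $\mathbb C\setminus\{0,1\}$ is an analytic function $f$ on $X$; if $c$ ends at $z$ we write $f^{[c]}(z)=f([c])$. Let $c_0(t)=\tfrac12e^{2\pi it}$ and $c_1(t)=1-\tfrac12e^{2\pi it}$ $(0\le t\le 1)$; for a loop $g$ at $1/2$, $gc$ is the path that follows first $g$, then $c$. For $\alpha\in\mathbb C\setminus\mathbb Z$ and $k\in\mathbb Z$ let $M_\alpha[k](z)=C_\alpha(\log z+2\pi ik)^{\alpha-1}$, the multivalued function on $\mathbb C\setminus\{0,1\}$ obtained by continuation from $z=1/2$ with $\log(1/2)=-\log2$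 and $0<\arg(-\log 2+2\pi ik)<2\pi$, and let $M_\alpha=M_\alpha[0]$. **Theorem.** (a) If $|z|<1$ and $\mathrm{Re}\,\alpha>0$, then $$\mathrm{Li}_\alpha(z)=\frac1{\Gamma(\alpha)}\int_0^\infty q^{\alpha-1}\frac{z}{e^q-z}\,dq,$$ and the integral converges absolutely. (b) If $|z|<1$ and $\alpha\in\mathbb C\setminus\mathbb Z$, then $$\mathrm{Li}_\alpha(z)=\frac{C_\alpha}{2\pi i}\int_\gamma q^{\alpha-1}\frac{z}{e^q-z}\,dq,$$ with absolute convergence, for every Hankel contour $\gamma$ around the positive real axis, i.e. every $C^1$ path in $\mathbb C\setminus[0,\infty)$ that comes in from $+\infty$ along a horizontal ray below the real axis and returns to $+\infty$ along a horizontal ray above it, such that all points $\log z+2\pi ik$ $(k\in\mathbb Z)$ are to its left: $e^{\mathrm{Re}\,q}>|z|$ for all $q$ on $\gamma$. (c) Let $\alpha\in\mathbb C\setminus\mathbb Z$. There is exactly one multivalued analytic function on $\mathbb C\setminus\{0,1\}$, again denoted $\mathrm{Li}_\alpha$, that agrees with the series near the base point. The functions $M_\alpha[k]$ are multivalued analytic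 on $\mathbb C\setminus\{0,1\}$. For every $z\in\mathbb C\setminus\{0,1\}$ and every path $c$ from $1/2$ to $z$ in $\mathbb C\setminus\{0,1\}$, $$\mathrm{Li}_\alpha^{[c_0c]}(z)=\mathrm{Li}_\alpha^{[c]}(z),\qquad \mathrm{Li}_\alpha^{[c_1c]}(z)=\mathrm{Li}_\alpha^{[c]}(z)-(1-e^{2\pi i\alpha})M_\alpha^{[c]}(z),$$ $$M_\alpha^{[c_0c]}(z)=M_\alpha^{[c]}[1](z),\qquad M_\alpha^{[c_1c]}(z)=M_\alpha^{[c]}(z)-(1-e^{2\pi i\alpha})M_\alpha^{[c]}(z)=e^{2\pi i\alpha}M_\alpha^{[c]}(z).$$ (d) Let $\alpha\in\mathbb C\setminus\mathbb Z$ with $\mathrm{Re}\,\alpha<0$. Then, for $0<|z|<1$ and with the principal $\log z$, $$\mathrm{Li}_\alpha(z)=C_\alpha\Bigl((\log z)^{\alpha-1}+\sum_{k=1}^\infty\bigl((\log z+2\pi ik)^{\alpha-1}+(\log z-2\pi ik)^{\alpha-1}\bigr)\Bigr),$$ uniformly on compact subsets of the punctured unit disc; and, as multivalued functions on $\mathbb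 C\setminus\{0,1\}$, $$\mathrm{Li}_\alpha=\sum_{k\in\mathbb Z}M_\alpha[k]:=\lim_{N\to\infty}\sum_{k=-N}^{N}M_\alpha[k],$$ uniformly on compact subsets of $X$. -/

import Mathlib

open Filter Topology MeasureTheory
open scoped unitInterval

noncomputable section

namespace FracPolylog

/-- The `α`-polylogarithm `Li_α(z) = ∑_{n ≥ 1} zⁿ / n^α` (used for `|z| < 1`). -/
def polylog (α z : ℂ) : ℂ :=
  ∑' n : ℕ, z ^ (n + 1) / ((n + 1 : ℕ) : ℂ) ^ α

/-- `C_α = e^{π i (-α - 1)} Γ(1 - α)`. -/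
def C (α : ℂ) : ℂ :=
  Complex.exp ((Real.pi : ℂ) * Complex.I * (-α - 1)) * Complex.Gamma (1 - α)

/-- The branch of the logarithm cut along the positive half-axis, with imaginary part in
`(0, 2π)` off the cut. -/
def logPos (q : ℂ) : ℂ :=
  Complex.log (-q) + (Real.pi : ℂ) * Complex.I

/-- The branch of `q ^ s` on `ℂ ∖ [0, ∞)` given by `0 < arg q < 2π`. -/
def powPos (q s : ℂ) : ℂ :=
  Complex.exp (s * logPos q)

/-- A Hankel contour around the positive half-axis: a `C¹` path in `ℂ ∖ [0, ∞)` that comes in from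
`+∞` along a horizontal ray below the axis, and goes back to `+∞` along a horizontal ray above it.
(The velocity may vanish, so contours with corners are covered after reparametrization.) -/
structure IsHankelContour (γ : ℝ → ℂ) : Prop where
  contDiff : ContDiff ℝ 1 γ
  avoids : ∀ t, ¬ (0 ≤ (γ t).re ∧ (γ t).im = 0)
  lower : ∃ δ > (0 : ℝ), ∃ T : ℝ, ∀ t ≤ T, γ t = ((-t : ℝ) : ℂ) - (δ : ℂ) * Complex.I
  upper : ∃ δ > (0 : ℝ), ∃ T : ℝ, ∀ t ≥ T, γ t = (t : ℂ) + (δ : ℂ) * Complex.I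

/-- The plane punctured at `0` and `1`. -/
abbrev Omega : Set ℂ := {0, 1}ᶜ

/-- The base point `1/2`. -/
def base : Omega := ⟨1 / 2, by norm_num⟩

/-- The universal cover of `ℂ ∖ {0, 1}` based at `1/2`: a point is a homotopy class (with fixed
end points) of paths from `1/2` to some point `pt`. -/
@[ext]
structure Cover where
  /-- the end point of the path -/
  pt : Omega
  /-- the homotopy class of the path -/
  cls : Path.Homotopic.Quotient base pt

namespace Cover

/-- The class of the constant path. -/
def basePt : Cover := ⟨base, Path.Homotopic.Quotient.refl base⟩

/-- The points `[c · p]` for `x = [c]`, where `p` is a path that stays in the disc of radius `r`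
around the end point of `c`. -/
def sheet (x : Cover) (r : ℝ) : Set Cover :=
  {y | ∃ p : Path x.pt y.pt, (∀ t : I, (p t : ℂ) ∈ Metric.ball (x.pt : ℂ) r) ∧
    y.cls = x.cls.trans (Path.Homotopic.Quotient.mk p)}

theorem sheet_mono (x : Cover) {r s : ℝ} (h : r ≤ s) : x.sheet r ⊆ x.sheet s :=
  fun _ ⟨p, hp, hy⟩ ↦ ⟨p, fun t ↦ Metric.ball_subset_ball h (hp t), hy⟩

/-- The usual topology of the universal cover, generated by the sheets. -/
instance : TopologicalSpace Cover where
  IsOpen S := ∀ x ∈ S, ∃ r > (0 : ℝ), x.sheet r ⊆ S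
  isOpen_univ := fun _ _ ↦ ⟨1, one_pos, Set.subset_univ _⟩
  isOpen_inter := fun S T hS hT x hx ↦ by
    obtain ⟨r, hr, hrS⟩ := hS x hx.1
    obtain ⟨s, hs, hsT⟩ := hT x hx.2
    exact ⟨min r s, lt_min hr hs, Set.subset_inter
      ((x.sheet_mono (min_le_left r s)).trans hrS)
      ((x.sheet_mono (min_le_right r s)).trans hsT)⟩
  isOpen_sUnion := fun 𝒮 h𝒮 x ⟨S, hS, hx⟩ ↦ by
    obtain ⟨r, hr, hrS⟩ := h𝒮 S hS x hx
    exact ⟨r, hr, hrS.trans (Set.subset_sUnion_of_mem hS)⟩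

/-- The action of the fundamental group: `g · [c] = [g c]` (first `g`, then `c`). -/
def act (g : Path base base) (x : Cover) : Cover :=
  ⟨x.pt, (Path.Homotopic.Quotient.mk g).trans x.cls⟩

end Cover

/-- A multivalued analytic function on `ℂ ∖ {0, 1}` is an analytic function on the universal
cover, where the projection to the end point serves as local coordinate. -/
def IsMultivaluedAnalytic (F : Cover → ℂ) : Prop :=
  ∀ x : Cover, ∃ g : ℂ → ℂ, AnalyticAt ℂ g (x.pt : ℂ) ∧
    ∃ r > (0 : ℝ), ∀ y ∈ x.sheet r, F y = g (y.pt : ℂ)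

/-- `F` is a multivalued analytic function on `ℂ ∖ {0, 1}` that continues the germ of `f` at the
base point. -/
def IsAnalyticContinuation (f : ℂ → ℂ) (F : Cover → ℂ) : Prop :=
  IsMultivaluedAnalytic F ∧ ∃ r > (0 : ℝ), ∀ y ∈ Cover.basePt.sheet r, F y = f (y.pt : ℂ)

/-- The loop `c₀(t) = (1/2) e^{2π i t}` around `0`. -/
def loopZero : Path base base where
  toFun t := ⟨1 / 2 * Complex.exp (((2 * Real.pi * (t : ℝ) : ℝ) : ℂ) * Complex.I), by
    have h : ‖1 / 2 * Complex.exp (((2 * Real.pi * (t : ℝ) : ℝ) : ℂ) * Complex.I)‖ = 1 / 2 := by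
      rw [norm_mul, Complex.norm_exp_ofReal_mul_I]; norm_num
    simp only [Set.mem_compl_iff, Set.mem_insert_iff, Set.mem_singleton_iff, not_or]
    constructor <;> intro h0 <;> rw [h0] at h <;> norm_num at h⟩
  continuous_toFun := by fun_prop
  source' := by ext; simp [base]
  target' := by ext; simp [base]

/-- The loop `c₁(t) = 1 - (1/2) e^{2π i t}` around `1`. -/
def loopOne : Path base base where
  toFun t := ⟨1 - 1 / 2 * Complex.exp (((2 * Real.pi * (t : ℝ) : ℝ) : ℂ) * Complex.I), by
    have h : ‖1 / 2 * Complex.exp (((2 * Real.pi * (t : ℝ) : ℝ) : ℂ) * Complex.I)‖ = 1 / 2 := by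
      rw [norm_mul, Complex.norm_exp_ofReal_mul_I]; norm_num
    simp only [Set.mem_compl_iff, Set.mem_insert_iff, Set.mem_singleton_iff, not_or]
    constructor <;> intro h0
    · rw [← sub_eq_zero.mp h0] at h; norm_num at h
    · rw [sub_eq_self.mp h0] at h; norm_num at h⟩
  continuous_toFun := by fun_prop
  source' := by ext; simp [base]; norm_num
  target' := by ext; simp [base]; norm_num

/-- `exp : ℂ ∖ 2πiℤ → ℂ ∖ {0, 1}` is a covering map. -/
theorem isCoveringMap_exp_Omega : IsCoveringMap (Omega.restrictPreimage Complex.exp) :=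
  (Complex.isCoveringMapOn_exp.mono (by intro z hz; simp_all)).isCoveringMap_restrictPreimage

/-- The logarithm `-log 2` of the base point. -/
def logBase : (Omega.restrictPreimage Complex.exp) ⁻¹' {base} :=
  have h : Complex.exp (((-Real.log 2 : ℝ) : ℂ)) = 1 / 2 := by
    rw [← Complex.ofReal_exp, Real.exp_neg, Real.exp_log two_pos]; norm_num
  ⟨⟨((-Real.log 2 : ℝ) : ℂ), by rw [Set.mem_preimage, h]; exact base.2⟩, Subtype.ext h⟩

/-- For `[c]` in the universal cover, the class of the path `log c` in `ℂ ∖ 2πiℤ` that lifts `c`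
through `exp` and starts at `-log 2`. -/
def logLift (x : Cover) :
    Path.Homotopic.Quotient logBase.1 (isCoveringMap_exp_Omega.monodromy x.cls logBase).1 :=
  isCoveringMap_exp_Omega.liftPathQuotient x.cls logBase

/-- The translation `w ↦ w + 2πik`, which has no zeros on `ℂ ∖ 2πiℤ`. -/
def shift (k : ℤ) : C(Complex.exp ⁻¹' Omega, {z : ℂ // z ≠ 0}) where
  toFun w := ⟨(w : ℂ) + 2 * (Real.pi : ℂ) * Complex.I * (k : ℂ), fun h ↦ by
    have hw : (w : ℂ) = ((-k : ℤ) : ℂ) * (2 * (Real.pi : ℂ) * Complex.I) := by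
      push_cast; linear_combination h
    exact w.2 (by rw [hw, Complex.exp_int_mul_two_pi_mul_I]; simp)⟩
  continuous_toFun := by fun_prop

/-- The start value `logPos (-log 2 + 2πik)` of `log (log z + 2πik)`. -/
def loglogBase (k : ℤ) :
    (fun z : ℂ ↦ (⟨_, z.exp_ne_zero⟩ : {z : ℂ // z ≠ 0})) ⁻¹' {shift k logBase.1} :=
  ⟨logPos (shift k logBase.1 : ℂ), Subtype.ext (by
    simp only [logPos]
    rw [Complex.exp_add, Complex.exp_log (neg_ne_zero.mpr (shift k logBase.1).2),
      Complex.exp_pi_mul_I]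
    ring)⟩

/-- The value at `[c]` of `log (log z + 2πik)`, continued along `c`. -/
def loglog (k : ℤ) (x : Cover) : ℂ :=
  (Complex.isCoveringMap_exp.monodromy ((logLift x).map (shift k)) (loglogBase k)).1

/-- The multivalued function `M_α[k](z) = C_α (log z + 2πik)^{α - 1}` on `ℂ ∖ {0, 1}`, started at
`z = 1/2` with `log z = -log 2` and `0 < arg (log z + 2πik) < 2π`. -/
def M (α : ℂ) (k : ℤ) (x : Cover) : ℂ :=
  C α * Complex.exp ((α - 1) * loglog k x)

end FracPolylog

end

open FracPolylog

/-!
Everything is read off in the variable `w = log z`. For `Re α < 0`, Poisson summation of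
`x^{-α} e^{wx}` on `x > 0` gives Lipschitz's formula `Li_α (e^w) = ∑ₖ C_α (w + 2πik)^{α-1}` for
`Re w < 0` (`polylog_exp_eq_tsum`). The terms with `|k| > N` converge normally on a disc around `0`
whose radius grows like `2πN`, so that `Li_α (e^w)` minus the finitely many terms with `|k| ≤ N`
extends to that disc. Since `d/dw Li_α (e^w) = Li_{α-1} (e^w)`, and the terms behave in the same
way, taking primitives carries this extension property from `α - 1` to `α`, hence to all
`α ∉ ℤ` (`exists_remainder`).

On the universal cover, `[c] ↦ log z` is continued along `c` (`logCover`). If this continuation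
stays in the disc of index `N`, put `Li_α [c] = R_N (log z) + ∑_{|k| ≤ N} M_α[k] [c]` with the
remainder `R_N` just described. The value does not depend on `N`
(`IsRemainder.polylogCover_eq`), because the terms that are moved are single-valued in the smaller
disc. This gives the continuation, and for `Re α < 0` its decomposition as `∑ₖ M_α[k]`. A germ has
at most one continuation since the cover is connected (`IsMultivaluedAnalytic.eq_of_germ`).

For the monodromy, explicit logarithms along the two loops show that `c₀` adds `2πi` to `log z`,
while `c₁` leaves `log z` unchanged and adds `2πi` to `log (log z)`, but not to
`log (log z + 2πik)` for `k ≠ 0`. So `c₁` changes only the summand `M_α[0]` of `Li_α`. Along `c₀`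
the continuation stays in the unit disc, where it is the series.

The two integral representations come from expanding `z / (e^q - z) = ∑ zⁿ e^{-nq}`. Over the real
axis each term is Euler's integral. Over a Hankel contour it is Hankel's integral
(`IsHankelContour.integral_eq`): for `Re α > 0` the integrand has the primitive
`q^α ∫₀¹ x^{α-1} e^{-rqx} dx` on the slit plane, with known limits at both ends, and integration by
parts extends the formula to other `α`.
-/

noncomputable section

namespace FracPolylog

/-! ### Logarithms along paths -/

/-- `v` is a continuous choice of logarithm along the path `c`, starting from `-log 2`. -/
structure IsLogAlong {z : Omega} (c : Path base z) (v : I → ℂ) : Prop where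
  continuous : Continuous v
  zero : v 0 = ((-Real.log 2 : ℝ) : ℂ)
  exp_eq : ∀ t, Complex.exp (v t) = c t

/-- `u` is a continuous choice of the logarithm of `v + 2πik`, starting from the value of
`logPos`. -/
structure IsLogLogAlong (k : ℤ) (v u : I → ℂ) : Prop where
  continuous : Continuous u
  zero : u 0 = logPos (v 0 + 2 * (Real.pi : ℂ) * Complex.I * (k : ℂ))
  exp_eq : ∀ t, Complex.exp (u t) = v t + 2 * (Real.pi : ℂ) * Complex.I * (k : ℂ)

theorem exists_isLogAlong {z : Omega} (c : Path base z) : ∃ v, IsLogAlong c v := by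
  have h0 : (c : C(I, Omega)) 0 = Omega.restrictPreimage Complex.exp logBase.1 := by
    rw [show Omega.restrictPreimage Complex.exp logBase.1 = base from logBase.2]
    exact c.source
  refine ⟨fun t ↦ (isCoveringMap_exp_Omega.liftPath c logBase.1 h0 t).1, by fun_prop, ?_,
    fun t ↦ ?_⟩
  · rw [isCoveringMap_exp_Omega.liftPath_zero]; rfl
  · exact congrArg Subtype.val (congrFun (isCoveringMap_exp_Omega.liftPath_lifts c logBase.1 h0) t)

theorem IsLogAlong.add_ne_zero {z : Omega} {c : Path base z} {v : I → ℂ} (hv : IsLogAlong c v)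
    (k : ℤ) (t : I) : v t + 2 * (Real.pi : ℂ) * Complex.I * (k : ℂ) ≠ 0 := fun h ↦ by
  have hw : v t = ((-k : ℤ) : ℂ) * (2 * (Real.pi : ℂ) * Complex.I) := by
    push_cast; linear_combination h
  have := hv.exp_eq t
  rw [hw, Complex.exp_int_mul_two_pi_mul_I] at this
  exact (c t).2 (by simp [← this])

theorem exp_logPos {q : ℂ} (hq : q ≠ 0) : Complex.exp (logPos q) = q := by
  simp only [logPos]
  rw [Complex.exp_add, Complex.exp_log (neg_ne_zero.mpr hq), Complex.exp_pi_mul_I]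
  ring

theorem IsLogAlong.exists_isLogLogAlong {z : Omega} {c : Path base z} {v : I → ℂ}
    (hv : IsLogAlong c v) (k : ℤ) : ∃ u, IsLogLogAlong k v u := by
  let V : C(I, {z : ℂ // z ≠ 0}) :=
    ⟨fun t ↦ ⟨_, hv.add_ne_zero k t⟩, by have := hv.continuous; fun_prop⟩
  have h0 : V 0 = (fun z : ℂ ↦ (⟨_, z.exp_ne_zero⟩ : {z : ℂ // z ≠ 0}))
      (logPos (v 0 + 2 * (Real.pi : ℂ) * Complex.I * (k : ℂ))) :=
    Subtype.ext (exp_logPos (hv.add_ne_zero k 0)).symm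
  refine ⟨Complex.isCoveringMap_exp.liftPath V _ h0, by fun_prop,
    Complex.isCoveringMap_exp.liftPath_zero _ _ h0, fun t ↦ ?_⟩
  exact congrArg Subtype.val (congrFun (Complex.isCoveringMap_exp.liftPath_lifts V _ h0) t)

/-- The value at `[c]` of `log z`, continued along `c` from `-log 2`. -/
def logCover (x : Cover) : ℂ := (isCoveringMap_exp_Omega.monodromy x.cls logBase).1.1

theorem IsLogAlong.liftPath_eq {z : Omega} {c : Path base z} {v : I → ℂ} (hv : IsLogAlong c v)
    (h0 : (c : C(I, Omega)) 0 = Omega.restrictPreimage Complex.exp logBase.1) :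
    (fun t ↦ (⟨v t, by rw [Set.mem_preimage, hv.exp_eq]; exact (c t).2⟩ : Complex.exp ⁻¹' Omega)) =
      isCoveringMap_exp_Omega.liftPath c logBase.1 h0 := by
  rw [isCoveringMap_exp_Omega.eq_liftPath_iff]
  have := hv.continuous
  exact ⟨by fun_prop, funext fun t ↦ Subtype.ext (hv.exp_eq t), Subtype.ext hv.zero⟩

theorem IsLogAlong.logCover_eq {z : Omega} {c : Path base z} {v : I → ℂ} (hv : IsLogAlong c v) :
    logCover ⟨z, .mk c⟩ = v 1 :=
  (congrArg Subtype.val (congrFun (hv.liftPath_eq (c.source.trans logBase.2.symm)) 1)).symm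

theorem IsLogAlong.loglog_eq {z : Omega} {c : Path base z} {v u : I → ℂ} (hv : IsLogAlong c v)
    {k : ℤ} (hu : IsLogLogAlong k v u) : loglog k ⟨z, .mk c⟩ = u 1 := by
  have h0 := c.source.trans logBase.2.symm
  have h := hv.liftPath_eq h0
  have hb : u 0 = (loglogBase k).1 := by rw [hu.zero, hv.zero]; rfl
  let Γ : C(I, {z : ℂ // z ≠ 0}) :=
    (shift k).comp (isCoveringMap_exp_Omega.liftPath c logBase.1 h0)
  have hΓ0 : Γ 0 = (fun z : ℂ ↦ (⟨_, z.exp_ne_zero⟩ : {z : ℂ // z ≠ 0})) (loglogBase k).1 := by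
    rw [show (fun z : ℂ ↦ (⟨_, z.exp_ne_zero⟩ : {z : ℂ // z ≠ 0})) (loglogBase k).1 =
      shift k logBase.1 from (loglogBase k).2]
    simp only [Γ, ContinuousMap.comp_apply, isCoveringMap_exp_Omega.liftPath_zero]
  have key : u = Complex.isCoveringMap_exp.liftPath Γ (loglogBase k).1 hΓ0 := by
    rw [Complex.isCoveringMap_exp.eq_liftPath_iff]
    refine ⟨hu.continuous, funext fun t ↦ Subtype.ext ?_, hb⟩
    simp only [Function.comp_apply, Γ, ContinuousMap.comp_apply, ← h, hu.exp_eq]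
    rfl
  exact (congrFun key 1).symm

/-- Pairs of functions along two composable paths can be joined. -/
theorem exists_concat {X E : Type*} [TopologicalSpace X] [TopologicalSpace E] {a b d : X}
    (c : Path a b) (p : Path b d) {v v' : I → E} (hv : Continuous v) (hv' : Continuous v')
    (h : v 1 = v' 0) : ∃ w : I → E, Continuous w ∧ w 0 = v 0 ∧ w 1 = v' 1 ∧
      ∀ Q : X → E → Prop, (∀ t, Q (c t) (v t)) → (∀ t, Q (p t) (v' t)) →
        ∀ t, Q (c.trans p t) (w t) := by
  let A : Path (v 0) (v 1) := ⟨⟨v, hv⟩, rfl, rfl⟩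
  let B : Path (v 1) (v' 1) := ⟨⟨v', hv'⟩, h.symm, rfl⟩
  refine ⟨A.trans B, (A.trans B).continuous, (A.trans B).source, (A.trans B).target,
    fun Q h1 h2 t ↦ ?_⟩
  rw [Path.trans_apply, Path.trans_apply]
  split_ifs
  · exact h1 _
  · exact h2 _

theorem Cover.exists_path (x : Cover) :
    ∃ c : Path base x.pt, x = ⟨x.pt, .mk c⟩ ∧ x.cls = .mk c := by
  obtain ⟨z, q⟩ := x
  induction q using Path.Homotopic.Quotient.ind with
  | mk c => exact ⟨c, rfl, rfl⟩

theorem exp_logCover (x : Cover) : Complex.exp (logCover x) = x.pt := by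
  obtain ⟨c, hc, hcls⟩ := x.exists_path
  obtain ⟨v, hv⟩ := exists_isLogAlong c
  rw [hc, hv.logCover_eq, hv.exp_eq, c.target]

theorem logCover_add_ne_zero (x : Cover) (k : ℤ) :
    logCover x + 2 * (Real.pi : ℂ) * Complex.I * (k : ℂ) ≠ 0 := by
  obtain ⟨c, hc, hcls⟩ := x.exists_path
  obtain ⟨v, hv⟩ := exists_isLogAlong c
  rw [hc, hv.logCover_eq]
  exact hv.add_ne_zero k 1

theorem exp_loglog (k : ℤ) (x : Cover) :
    Complex.exp (loglog k x) = logCover x + 2 * (Real.pi : ℂ) * Complex.I * (k : ℂ) := by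
  obtain ⟨c, hc, hcls⟩ := x.exists_path
  obtain ⟨v, hv⟩ := exists_isLogAlong c
  obtain ⟨u, hu⟩ := hv.exists_isLogLogAlong k
  rw [hc, hv.logCover_eq, hv.loglog_eq hu, hu.exp_eq]

/-- The points `[c]` for which the continuation of `log` along `c` can be kept in `S`. -/
def reach (S : Set ℂ) : Set Cover :=
  {x | ∃ (c : Path base x.pt) (v : I → ℂ), x.cls = .mk c ∧ IsLogAlong c v ∧ ∀ t, v t ∈ S}

theorem reach_mono {S T : Set ℂ} (h : S ⊆ T) : reach S ⊆ reach T :=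
  fun _ ⟨c, v, hc, hv, hS⟩ ↦ ⟨c, v, hc, hv, fun t ↦ h (hS t)⟩

theorem logCover_mem_of_mem_reach {S : Set ℂ} {x : Cover} (hx : x ∈ reach S) : logCover x ∈ S := by
  obtain ⟨c, v, hc, hv, hS⟩ := hx
  have : x = ⟨x.pt, .mk c⟩ := Cover.ext rfl (heq_of_eq hc)
  rw [this, hv.logCover_eq]
  exact hS 1

/-- Every path has a logarithm along it that stays in some disc. -/
theorem exists_mem_reach_ball (x : Cover) : ∃ r, x ∈ reach (Metric.ball 0 r) := by
  obtain ⟨c, hc, hcls⟩ := x.exists_path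
  obtain ⟨v, hv⟩ := exists_isLogAlong c
  obtain ⟨B, hB⟩ := isCompact_univ.exists_bound_of_continuousOn hv.continuous.continuousOn
  refine ⟨B + 1, c, v, hcls, hv, fun t ↦ ?_⟩
  rw [mem_ball_zero_iff]
  linarith [hB t trivial]

/-- Where `w + 2πik` stays off `[0, ∞)`, the continued logarithm of `log z + 2πik` is the branch
`logPos`. -/
theorem loglog_eq_logPos {S : Set ℂ} {k : ℤ}
    (hS : ∀ w ∈ S, -(w + 2 * (Real.pi : ℂ) * Complex.I * (k : ℂ)) ∈ Complex.slitPlane)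
    {x : Cover} (hx : x ∈ reach S) :
    loglog k x = logPos (logCover x + 2 * (Real.pi : ℂ) * Complex.I * (k : ℂ)) := by
  obtain ⟨c, v, hc, hv, hvS⟩ := hx
  have : x = ⟨x.pt, .mk c⟩ := Cover.ext rfl (heq_of_eq hc)
  rw [this, hv.logCover_eq]
  refine hv.loglog_eq (u := fun t ↦ logPos (v t + 2 * (Real.pi : ℂ) * Complex.I * (k : ℂ)))
    ⟨?_, rfl, fun t ↦ exp_logPos (hv.add_ne_zero k t)⟩
  have := hv.continuous
  exact (Continuous.clog (by fun_prop) fun t ↦ hS _ (hvS t)).add continuous_const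

/-- Continuing further along `p` from `x`: explicit logarithms along `p` give the new values. -/
theorem continue_along {x y : Cover} {p : Path x.pt y.pt} (hp : y.cls = x.cls.trans (.mk p))
    {v : I → ℂ} (hv : Continuous v) (hv0 : v 0 = logCover x) (hvp : ∀ t, Complex.exp (v t) = p t) :
    logCover y = v 1 ∧
    (∀ (k : ℤ) (u : I → ℂ), Continuous u → u 0 = loglog k x →
      (∀ t, Complex.exp (u t) = v t + 2 * (Real.pi : ℂ) * Complex.I * (k : ℂ)) →
      loglog k y = u 1) ∧
    ∀ S : Set ℂ, x ∈ reach S → (∀ t, v t ∈ S) → y ∈ reach S := by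
  refine ⟨?_, fun k u hu hu0 huv ↦ ?_, ?_⟩
  · obtain ⟨c, hc, hcls⟩ := x.exists_path
    obtain ⟨V, hV⟩ := exists_isLogAlong c
    have hy : y = ⟨y.pt, .mk (c.trans p)⟩ := Cover.ext rfl (heq_of_eq (by rw [hp, hcls]; rfl))
    have h1 : V 1 = v 0 := by rw [hv0, hc, hV.logCover_eq]
    obtain ⟨w, hw, hw0, hw1, hQ⟩ := exists_concat c p hV.continuous hv h1
    rw [hy, ← hw1]
    exact IsLogAlong.logCover_eq
      ⟨hw, hw0.trans hV.zero, hQ (fun z e ↦ Complex.exp e = z) hV.exp_eq hvp⟩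
  · obtain ⟨c, hc, hcls⟩ := x.exists_path
    obtain ⟨V, hV⟩ := exists_isLogAlong c
    obtain ⟨U, hU⟩ := hV.exists_isLogLogAlong k
    have hy : y = ⟨y.pt, .mk (c.trans p)⟩ := Cover.ext rfl (heq_of_eq (by rw [hp, hcls]; rfl))
    have h1 : V 1 = v 0 := by rw [hv0, hc, hV.logCover_eq]
    have h2 : U 1 = u 0 := by rw [hu0, hc, hV.loglog_eq hU]
    obtain ⟨w, hw, hw0, hw1, hQ⟩ := exists_concat c p (v := fun t ↦ (V t, U t))
      (v' := fun t ↦ (v t, u t)) (hV.continuous.prodMk hU.continuous) (hv.prodMk hu)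
      (Prod.ext h1 h2)
    have hV' : IsLogAlong (c.trans p) (fun t ↦ (w t).1) :=
      ⟨by fun_prop, by rw [hw0]; exact hV.zero,
        hQ (fun z e ↦ Complex.exp e.1 = z) hV.exp_eq hvp⟩
    have hU' : IsLogLogAlong k (fun t ↦ (w t).1) (fun t ↦ (w t).2) :=
      ⟨by fun_prop, by simp only [hw0]; exact hU.zero,
        hQ (fun z e ↦ Complex.exp e.2 = e.1 + 2 * (Real.pi : ℂ) * Complex.I * (k : ℂ))
          hU.exp_eq huv⟩
    rw [hy, hV'.loglog_eq hU', hw1]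
  · rintro S ⟨c, V, hcls, hV, hVS⟩ hvS
    have hx : x = ⟨x.pt, .mk c⟩ := Cover.ext rfl (heq_of_eq hcls)
    have h1 : V 1 = v 0 := by rw [hv0, hx, hV.logCover_eq]
    obtain ⟨w, hw, hw0, hw1, hQ⟩ := exists_concat c p hV.continuous hv h1
    exact ⟨c.trans p, w, by rw [hp, hcls]; rfl,
      ⟨hw, hw0.trans hV.zero, hQ (fun z e ↦ Complex.exp e = z) hV.exp_eq hvp⟩,
      hQ (fun _ e ↦ e ∈ S) hVS hvS⟩

/-- The branch of `log` near the end point of `x` that takes the value `logCover x` there. -/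
def localLog (x : Cover) (z : ℂ) : ℂ := logCover x + Complex.log (z / x.pt)

theorem pt_ne_zero (x : Cover) : (x.pt : ℂ) ≠ 0 := fun h ↦ x.pt.2 (by simp [h])

theorem localLog_self (x : Cover) : localLog x x.pt = logCover x := by
  simp [localLog, div_self (pt_ne_zero x)]

theorem exp_localLog (x : Cover) {z : ℂ} (hz : z ≠ 0) : Complex.exp (localLog x z) = z := by
  rw [localLog, Complex.exp_add, exp_logCover, Complex.exp_log (div_ne_zero hz (pt_ne_zero x)),
    mul_div_cancel₀ _ (pt_ne_zero x)]

theorem analyticAt_localLog (x : Cover) : AnalyticAt ℂ (localLog x) x.pt := by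
  refine analyticAt_const.add (AnalyticAt.clog (by fun_prop) ?_)
  rw [div_self (pt_ne_zero x)]; simp

/-- On a small sheet, `log` and `log (log + 2πik)` are continued by explicit branches. -/
theorem exists_sheet_logCover (x : Cover) : ∃ r > (0 : ℝ),
    (∀ z ∈ Metric.ball (x.pt : ℂ) r, z ≠ 0 ∧ ContinuousAt (localLog x) z) ∧
    ∀ y ∈ x.sheet r, logCover y = localLog x y.pt := by
  have h1 : ∀ᶠ z in 𝓝 (x.pt : ℂ), z ≠ 0 ∧ ContinuousAt (localLog x) z :=
    (eventually_ne_nhds (pt_ne_zero x)).and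
      ((analyticAt_localLog x).eventually_analyticAt.mono fun z hz ↦ hz.continuousAt)
  obtain ⟨r, hr, h⟩ := Metric.eventually_nhds_iff_ball.mp h1
  refine ⟨r, hr, h, fun y ⟨p, hpr, hp⟩ ↦ ?_⟩
  have := (continue_along hp (v := fun t ↦ localLog x (p t)) ?_ ?_ ?_).1
  · simpa using this
  · rw [continuous_iff_continuousAt]
    intro t
    exact (h _ (hpr t)).2.comp (f := fun t ↦ ((p t : Omega) : ℂ)) (by fun_prop)
  · simp [localLog_self]
  · exact fun t ↦ exp_localLog x (h _ (hpr t)).1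

theorem exists_sheet_subset_reach {S : Set ℂ} (hS : IsOpen S) {x : Cover} (hx : x ∈ reach S) :
    ∃ r > (0 : ℝ), x.sheet r ⊆ reach S := by
  obtain ⟨r, hr, h, -⟩ := exists_sheet_logCover x
  have : ∀ᶠ z in 𝓝 (x.pt : ℂ), localLog x z ∈ S :=
    (analyticAt_localLog x).continuousAt.eventually_mem
      (hS.mem_nhds (by rw [localLog_self]; exact logCover_mem_of_mem_reach hx))
  obtain ⟨s, hs, h'⟩ := Metric.eventually_nhds_iff_ball.mp this
  refine ⟨min r s, lt_min hr hs, fun y ⟨p, hpr, hp⟩ ↦ ?_⟩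
  have hpr1 : ∀ t, (p t : ℂ) ∈ Metric.ball (x.pt : ℂ) r :=
    fun t ↦ Metric.ball_subset_ball (min_le_left _ _) (hpr t)
  refine (continue_along hp (v := fun t ↦ localLog x (p t)) ?_ ?_ ?_).2.2 S hx
    fun t ↦ h' _ (Metric.ball_subset_ball (min_le_right _ _) (hpr t))
  · rw [continuous_iff_continuousAt]
    intro t
    exact (h _ (hpr1 t)).2.comp (f := fun t ↦ ((p t : Omega) : ℂ)) (by fun_prop)
  · simp [localLog_self]
  · exact fun t ↦ exp_localLog x (h _ (hpr1 t)).1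

/-- The branch of `log (log z + 2πik)` near the end point of `x` that takes the value `loglog k x`
there. -/
def localLogLog (k : ℤ) (x : Cover) (z : ℂ) : ℂ :=
  loglog k x + Complex.log ((localLog x z + 2 * (Real.pi : ℂ) * Complex.I * (k : ℂ)) /
    (logCover x + 2 * (Real.pi : ℂ) * Complex.I * (k : ℂ)))

theorem localLogLog_self (k : ℤ) (x : Cover) : localLogLog k x x.pt = loglog k x := by
  simp [localLogLog, localLog_self, div_self (logCover_add_ne_zero x k)]

theorem analyticAt_localLogLog (k : ℤ) (x : Cover) : AnalyticAt ℂ (localLogLog k x) x.pt := by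
  have := analyticAt_localLog x
  refine analyticAt_const.add (AnalyticAt.clog (by fun_prop) ?_)
  rw [localLog_self, div_self (logCover_add_ne_zero x k)]; simp

theorem exists_sheet_loglog (k : ℤ) (x : Cover) : ∃ r > (0 : ℝ),
    ∀ y ∈ x.sheet r, loglog k y = localLogLog k x y.pt := by
  obtain ⟨r, hr, h, -⟩ := exists_sheet_logCover x
  have h1 : ∀ᶠ z in 𝓝 (x.pt : ℂ), localLog x z + 2 * (Real.pi : ℂ) * Complex.I * (k : ℂ) ≠ 0 ∧
      ContinuousAt (localLogLog k x) z := by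
    refine .and ?_
      ((analyticAt_localLogLog k x).eventually_analyticAt.mono fun z hz ↦ hz.continuousAt)
    have := (analyticAt_localLog x).continuousAt
    refine ContinuousAt.eventually_ne (by fun_prop) ?_
    rw [localLog_self]; exact logCover_add_ne_zero x k
  obtain ⟨s, hs, h'⟩ := Metric.eventually_nhds_iff_ball.mp h1
  refine ⟨min r s, lt_min hr hs, fun y ⟨p, hpr, hp⟩ ↦ ?_⟩
  have hpr1 : ∀ t, (p t : ℂ) ∈ Metric.ball (x.pt : ℂ) r :=
    fun t ↦ Metric.ball_subset_ball (min_le_left _ _) (hpr t)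
  have hpr2 : ∀ t, (p t : ℂ) ∈ Metric.ball (x.pt : ℂ) s :=
    fun t ↦ Metric.ball_subset_ball (min_le_right _ _) (hpr t)
  have := (continue_along hp (v := fun t ↦ localLog x (p t)) ?_ ?_ ?_).2.1 k
    (fun t ↦ localLogLog k x (p t)) ?_ ?_ ?_
  · simpa using this
  · rw [continuous_iff_continuousAt]
    intro t
    exact (h _ (hpr1 t)).2.comp (f := fun t ↦ ((p t : Omega) : ℂ)) (by fun_prop)
  · simp [localLog_self]
  · exact fun t ↦ exp_localLog x (h _ (hpr1 t)).1
  · rw [continuous_iff_continuousAt]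
    intro t
    exact (h' _ (hpr2 t)).2.comp (f := fun t ↦ ((p t : Omega) : ℂ)) (by fun_prop)
  · simp [localLogLog_self]
  · intro t
    have := logCover_add_ne_zero x k
    rw [localLogLog, Complex.exp_add, exp_loglog,
      Complex.exp_log (div_ne_zero (h' _ (hpr2 t)).1 this), mul_div_cancel₀ _ this]

theorem isMultivaluedAnalytic_M (α : ℂ) (k : ℤ) : IsMultivaluedAnalytic (M α k) := fun x ↦ by
  obtain ⟨r, hr, h⟩ := exists_sheet_loglog k x
  have := analyticAt_localLogLog k x
  exact ⟨fun z ↦ C α * Complex.exp ((α - 1) * localLogLog k x z), by fun_prop, r, hr,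
    fun y hy ↦ by rw [M, h y hy]⟩

theorem isLogAlong_refl : IsLogAlong (Path.refl base) (fun _ ↦ ((-Real.log 2 : ℝ) : ℂ)) :=
  ⟨by fun_prop, rfl, fun _ ↦ by
    rw [← Complex.ofReal_exp, Real.exp_neg, Real.exp_log two_pos]
    exact (by simp [base] : ((2⁻¹ : ℝ) : ℂ) = (base : ℂ))⟩

theorem basePt_mem_reach {S : Set ℂ} (hS : ((-Real.log 2 : ℝ) : ℂ) ∈ S) : Cover.basePt ∈ reach S :=
  ⟨.refl _, _, rfl, isLogAlong_refl, fun _ ↦ hS⟩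

/-- Near the base point `logCover` is the principal logarithm. -/
theorem exists_basePt_sheet_log :
    ∃ r > (0 : ℝ), ∀ y ∈ Cover.basePt.sheet r, logCover y = Complex.log y.pt := by
  obtain ⟨r, hr, h⟩ := exists_sheet_subset_reach
    (S := {w | |w.im| < Real.pi}) (isOpen_lt (by fun_prop) (by fun_prop))
    (basePt_mem_reach (by rw [Set.mem_ofPred_eq, Complex.ofReal_im, abs_zero]; exact Real.pi_pos))
  refine ⟨r, hr, fun y hy ↦ ?_⟩
  have := logCover_mem_of_mem_reach (h hy)
  rw [Set.mem_ofPred_eq, abs_lt] at this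
  rw [← exp_logCover y, Complex.log_exp this.1 this.2.le]

theorem isOpen_re_neg : IsOpen {w : ℂ | w.re < 0} := isOpen_lt (by fun_prop) (by fun_prop)

theorem neg_add_mem_slitPlane {w : ℂ} (hw : w.re < 0) (k : ℤ) :
    -(w + 2 * (Real.pi : ℂ) * Complex.I * (k : ℂ)) ∈ Complex.slitPlane := by
  left; simpa using hw

theorem isAnalyticContinuation_M (α : ℂ) (k : ℤ) : IsAnalyticContinuation
    (fun z ↦ C α * powPos (Complex.log z + 2 * (Real.pi : ℂ) * Complex.I * (k : ℂ)) (α - 1))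
    (M α k) := by
  refine ⟨isMultivaluedAnalytic_M α k, ?_⟩
  obtain ⟨r, hr, h⟩ := exists_basePt_sheet_log
  obtain ⟨s, hs, h'⟩ := exists_sheet_subset_reach isOpen_re_neg
    (basePt_mem_reach (neg_neg_of_pos (Real.log_pos one_lt_two)))
  refine ⟨min r s, lt_min hr hs, fun y hy ↦ ?_⟩
  simp only [M, powPos]
  rw [loglog_eq_logPos (fun w hw ↦ neg_add_mem_slitPlane hw k)
    (h' (Cover.sheet_mono _ (min_le_right _ _) hy)),
    h y (Cover.sheet_mono _ (min_le_left _ _) hy)]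

/-! ### Monodromy of the branches -/

theorem Cover.act_eq {g : Path base base} {x : Cover} {c : Path base x.pt} (hc : x.cls = .mk c) :
    x.act g = ⟨x.pt, .mk (g.trans c)⟩ := by
  simp only [Cover.act, hc]; rfl

/-- A loop `g` along which `log` increases by `2πim` and `log (log + 2πik)` ends at the branch
`logPos + 2πin` acts on the continued logarithms by a change of branch. -/
theorem loglog_act {g : Path base base} {v : I → ℂ} (hv : IsLogAlong g v) {m : ℤ}
    (hm : v 1 = ((-Real.log 2 : ℝ) : ℂ) + 2 * (Real.pi : ℂ) * Complex.I * (m : ℂ))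
    {k : ℤ} {u : I → ℂ} (hu : IsLogLogAlong k v u) {n : ℤ}
    (hn : u 1 = logPos (((-Real.log 2 : ℝ) : ℂ) +
      2 * (Real.pi : ℂ) * Complex.I * ((k + m : ℤ) : ℂ)) + 2 * (Real.pi : ℂ) * Complex.I * (n : ℂ))
    (x : Cover) :
    loglog k (x.act g) = loglog (k + m) x + 2 * (Real.pi : ℂ) * Complex.I * (n : ℂ) := by
  obtain ⟨c, hc, hcls⟩ := x.exists_path
  obtain ⟨V, hV⟩ := exists_isLogAlong c
  obtain ⟨U, hU⟩ := hV.exists_isLogLogAlong (k + m)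
  have hperiod : ∀ j : ℤ, Complex.exp (2 * (Real.pi : ℂ) * Complex.I * (j : ℂ)) = 1 := fun j ↦ by
    rw [mul_comm, Complex.exp_int_mul_two_pi_mul_I]
  have hVc := hV.continuous
  have hUc := hU.continuous
  obtain ⟨w, hw, hw0, hw1, hQ⟩ := exists_concat g c (v := fun t ↦ (v t, u t))
    (v' := fun t ↦ (V t + 2 * (Real.pi : ℂ) * Complex.I * (m : ℂ),
      U t + 2 * (Real.pi : ℂ) * Complex.I * (n : ℂ)))
    (hv.continuous.prodMk hu.continuous) (by fun_prop)
    (Prod.ext (by simp only [hm, hV.zero]) (by simp only [hn, hU.zero, hV.zero]))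
  have hV' : IsLogAlong (g.trans c) (fun t ↦ (w t).1) :=
    ⟨by fun_prop, by rw [hw0]; exact hv.zero,
      hQ (fun z e ↦ Complex.exp e.1 = z) hv.exp_eq fun t ↦ by
        simp only [Complex.exp_add, hperiod, mul_one, hV.exp_eq]⟩
  have hU' : IsLogLogAlong k (fun t ↦ (w t).1) (fun t ↦ (w t).2) :=
    ⟨by fun_prop, by simp only [hw0]; exact hu.zero,
      hQ (fun z e ↦ Complex.exp e.2 = e.1 + 2 * (Real.pi : ℂ) * Complex.I * (k : ℂ))
        hu.exp_eq fun t ↦ by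
          simp only [Complex.exp_add, hperiod, mul_one, hU.exp_eq]; push_cast; ring⟩
  rw [Cover.act_eq hcls, hV'.loglog_eq hU', hw1]
  simp only
  rw [← hV.loglog_eq hU, ← hc]

theorem act_mem_reach {g : Path base base} {v : I → ℂ} (hv : IsLogAlong g v) {m : ℤ}
    (hm : v 1 = ((-Real.log 2 : ℝ) : ℂ) + 2 * (Real.pi : ℂ) * Complex.I * (m : ℂ))
    {S T : Set ℂ} (hS : ∀ t, v t ∈ S)
    (hT : ∀ w ∈ T, w + 2 * (Real.pi : ℂ) * Complex.I * (m : ℂ) ∈ S) {x : Cover}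
    (hx : x ∈ reach T) :
    x.act g ∈ reach S ∧
      logCover (x.act g) = logCover x + 2 * (Real.pi : ℂ) * Complex.I * (m : ℂ) := by
  obtain ⟨c, V, hcls, hV, hVT⟩ := hx
  have hperiod : ∀ j : ℤ, Complex.exp (2 * (Real.pi : ℂ) * Complex.I * (j : ℂ)) = 1 := fun j ↦ by
    rw [mul_comm, Complex.exp_int_mul_two_pi_mul_I]
  have hVc := hV.continuous
  obtain ⟨w, hw, hw0, hw1, hQ⟩ := exists_concat g c (v := v)
    (v' := fun t ↦ V t + 2 * (Real.pi : ℂ) * Complex.I * (m : ℂ))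
    hv.continuous (by fun_prop) (by simp only [hm, hV.zero])
  have hw' : IsLogAlong (g.trans c) w :=
    ⟨hw, hw0.trans hv.zero, hQ (fun z e ↦ Complex.exp e = z) hv.exp_eq fun t ↦ by
      rw [Complex.exp_add, hperiod, mul_one, hV.exp_eq]⟩
  have hx : x = ⟨x.pt, .mk c⟩ := Cover.ext rfl (heq_of_eq hcls)
  rw [Cover.act_eq hcls]
  refine ⟨⟨g.trans c, w, rfl, hw', hQ (fun _ e ↦ e ∈ S) hS fun t ↦ hT _ (hVT t)⟩, ?_⟩
  rw [hw'.logCover_eq, hw1, ← hV.logCover_eq, ← hx]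

/-- The logarithm along `loopZero`. -/
def logLoopZero (t : I) : ℂ :=
  ((-Real.log 2 : ℝ) : ℂ) + ((2 * Real.pi * (t : ℝ) : ℝ) : ℂ) * Complex.I

theorem logLoopZero_re (t : I) : (logLoopZero t).re < 0 := by
  have : (logLoopZero t).re = -Real.log 2 := by
    rw [logLoopZero, Complex.add_re, Complex.re_ofReal_mul, Complex.I_re, mul_zero, add_zero,
      Complex.ofReal_re]
  rw [this]
  exact neg_neg_of_pos (Real.log_pos one_lt_two)

theorem exp_neg_log_two : Complex.exp ((-Real.log 2 : ℝ) : ℂ) = 1 / 2 := by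
  rw [← Complex.ofReal_exp, Real.exp_neg, Real.exp_log two_pos]; simp

theorem isLogAlong_loopZero : IsLogAlong loopZero logLoopZero := by
  refine ⟨by unfold logLoopZero; fun_prop, ?_, fun t ↦ ?_⟩
  · rw [logLoopZero]; simp
  · rw [logLoopZero, Complex.exp_add, exp_neg_log_two]; rfl

theorem logLoopZero_one : logLoopZero 1 =
    ((-Real.log 2 : ℝ) : ℂ) + 2 * (Real.pi : ℂ) * Complex.I * ((1 : ℤ) : ℂ) := by
  rw [logLoopZero]; push_cast; simp

theorem loglog_act_loopZero (k : ℤ) (x : Cover) : loglog k (x.act loopZero) = loglog (k + 1) x := by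
  have := loglog_act isLogAlong_loopZero logLoopZero_one (k := k) (n := 0)
    (u := fun t ↦ logPos (logLoopZero t + 2 * (Real.pi : ℂ) * Complex.I * (k : ℂ)))
    ⟨?_, rfl, fun t ↦ exp_logPos (isLogAlong_loopZero.add_ne_zero k t)⟩ ?_ x
  · simpa using this
  · have := isLogAlong_loopZero.continuous
    exact (Continuous.clog (by fun_prop)
      fun t ↦ neg_add_mem_slitPlane (logLoopZero_re t) k).add continuous_const
  · simp only [logLoopZero_one]
    push_cast
    ring_nf

/-- The point `e^{2πit}/2`, so that `loopOne` is `1 - halfCircle`. -/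
def halfCircle (t : I) : ℂ :=
  1 / 2 * Complex.exp (((2 * Real.pi * (t : ℝ) : ℝ) : ℂ) * Complex.I)

theorem norm_halfCircle (t : I) : ‖halfCircle t‖ = 1 / 2 := by
  rw [halfCircle, norm_mul, Complex.norm_exp_ofReal_mul_I]; norm_num

theorem continuous_halfCircle : Continuous halfCircle := by unfold halfCircle; fun_prop

theorem halfCircle_zero : halfCircle 0 = 1 / 2 := by simp [halfCircle]

theorem halfCircle_one : halfCircle 1 = 1 / 2 := by simp [halfCircle]

theorem halfCircle_ne_zero (t : I) : halfCircle t ≠ 0 := fun h ↦ by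
  have := norm_halfCircle t; rw [h] at this; norm_num at this

/-- The logarithm along `loopOne`. -/
def logLoopOne (t : I) : ℂ := Complex.log (1 + -halfCircle t)

theorem one_sub_halfCircle_mem (t : I) : 1 + -halfCircle t ∈ Complex.slitPlane :=
  Complex.mem_slitPlane_of_norm_lt_one (by rw [norm_neg, norm_halfCircle]; norm_num)

theorem log_one_half : Complex.log (1 / 2) = ((-Real.log 2 : ℝ) : ℂ) := by
  rw [← exp_neg_log_two, Complex.log_exp] <;> rw [Complex.ofReal_im] <;> linarith [Real.pi_pos]

theorem logLoopOne_zero : logLoopOne 0 = ((-Real.log 2 : ℝ) : ℂ) := by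
  rw [logLoopOne, halfCircle_zero, ← log_one_half]; norm_num

theorem logLoopOne_one : logLoopOne 1 = ((-Real.log 2 : ℝ) : ℂ) := by
  rw [logLoopOne, halfCircle_one, ← log_one_half]; norm_num

theorem isLogAlong_loopOne : IsLogAlong loopOne logLoopOne := by
  refine ⟨?_, logLoopOne_zero, fun t ↦ ?_⟩
  · have := continuous_halfCircle
    exact Continuous.clog (by fun_prop) one_sub_halfCircle_mem
  · rw [logLoopOne, Complex.exp_log (Complex.slitPlane_ne_zero (one_sub_halfCircle_mem t)),
      ← sub_eq_add_neg]
    rfl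

theorem norm_logLoopOne_add (t : I) : ‖logLoopOne t + halfCircle t‖ ≤ 1 / 4 := by
  have h := Complex.norm_log_one_add_sub_self_le (z := -halfCircle t)
    (by rw [norm_neg, norm_halfCircle]; norm_num)
  rw [norm_neg, norm_halfCircle, sub_neg_eq_add] at h
  exact h.trans (by norm_num)

/-- The quotient `-log (1 - ζ) / ζ` on the circle `|ζ| = 1/2`, which stays near `1`. -/
def loopOneRatio (t : I) : ℂ := -logLoopOne t / halfCircle t

theorem loopOneRatio_mem (t : I) : loopOneRatio t ∈ Complex.slitPlane := by
  have h : loopOneRatio t = 1 + -((logLoopOne t + halfCircle t) / halfCircle t) := by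
    have := halfCircle_ne_zero t
    rw [loopOneRatio]; field_simp; ring
  rw [h]
  refine Complex.mem_slitPlane_of_norm_lt_one ?_
  rw [norm_neg, norm_div, norm_halfCircle]
  linarith [norm_logLoopOne_add t]

/-- Along `loopOne` the value of `log (log z)` increases by `2πi`: the loop `log c₁` winds once
around `0`. -/
theorem loglog_zero_act_loopOne (x : Cover) :
    loglog 0 (x.act loopOne) = loglog 0 x + 2 * (Real.pi : ℂ) * Complex.I := by
  have h1 : Complex.log (loopOneRatio 0) = Complex.log ((Real.log 2 : ℝ) : ℂ) + Real.log 2 := by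
    rw [loopOneRatio, logLoopOne_zero, halfCircle_zero, ← Complex.ofReal_neg, neg_neg,
      div_eq_mul_inv, one_div, inv_inv, ← Complex.ofReal_log (Real.log_nonneg one_le_two),
      show ((Real.log 2 : ℝ) : ℂ) * 2 = ((Real.log 2 * 2 : ℝ) : ℂ) by push_cast; ring,
      ← Complex.ofReal_log (by positivity), Real.log_mul (by positivity) two_ne_zero]
    push_cast; ring
  have h2 : loopOneRatio 1 = loopOneRatio 0 := by
    simp only [loopOneRatio, logLoopOne_zero, logLoopOne_one, halfCircle_zero, halfCircle_one]
  have h3 : logPos ((-Real.log 2 : ℝ) : ℂ) =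
      Complex.log ((Real.log 2 : ℝ) : ℂ) + (Real.pi : ℂ) * Complex.I := by
    rw [logPos, ← Complex.ofReal_neg, neg_neg]
  -- With `ζ = halfCircle t`, factor `log (1 - ζ) = -ζ · loopOneRatio t` and take logarithms: only
  -- the factor `ζ` winds around `0`.
  have := loglog_act isLogAlong_loopOne (m := 0) (by rw [logLoopOne_one]; simp) (k := 0) (n := 1)
    (u := fun t ↦ Complex.log (loopOneRatio t) - Real.log 2 +
      ((2 * Real.pi * (t : ℝ) : ℝ) : ℂ) * Complex.I + (Real.pi : ℂ) * Complex.I)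
    ⟨?_, ?_, fun t ↦ ?_⟩ ?_ x
  · simpa using this
  · have := continuous_halfCircle
    have := isLogAlong_loopOne.continuous
    have : Continuous fun t ↦ Complex.log (loopOneRatio t) :=
      Continuous.clog (this.neg.div continuous_halfCircle halfCircle_ne_zero) loopOneRatio_mem
    fun_prop
  · simp only [h1, logLoopOne_zero, Int.cast_zero, mul_zero, add_zero, h3]
    simp
  · have h4 : Complex.exp (Complex.log 2) = 2 := Complex.exp_log two_ne_zero
    have h5 := halfCircle_ne_zero t
    have h6 : loopOneRatio t * halfCircle t = -logLoopOne t := div_mul_cancel₀ _ h5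
    rw [halfCircle] at h6
    simp only [Complex.exp_add, Complex.exp_sub, Complex.exp_pi_mul_I,
      Complex.ofReal_log zero_le_two, Complex.ofReal_ofNat, h4,
      Complex.exp_log (Complex.slitPlane_ne_zero (loopOneRatio_mem t)),
      Int.cast_zero, mul_zero, add_zero]
    linear_combination -h6
  · simp only [h1, h2, add_zero, Int.cast_zero, mul_zero, h3]
    simp
    ring

theorem norm_logLoopOne_le (t : I) : ‖logLoopOne t‖ ≤ 3 / 4 := by
  have h := norm_sub_le (logLoopOne t + halfCircle t) (halfCircle t)
  rw [add_sub_cancel_right, norm_halfCircle] at h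
  linarith [norm_logLoopOne_add t]

/-- If `|w| < 2π|k|`, then `w + 2πik` is not real, so it avoids `[0, ∞)`. -/
theorem neg_add_mem_slitPlane_of_norm {w : ℂ} {k : ℤ} (hw : ‖w‖ < 2 * Real.pi * |(k : ℝ)|) :
    -(w + 2 * (Real.pi : ℂ) * Complex.I * (k : ℂ)) ∈ Complex.slitPlane := by
  right
  intro h
  have h1 : w.im = -(2 * Real.pi * k) := by
    have : (-(w + 2 * (Real.pi : ℂ) * Complex.I * (k : ℂ))).im = -(w.im + 2 * Real.pi * k) := by
      simp
    linarith
  have h2 := Complex.abs_im_le_norm w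
  rw [h1, abs_neg, abs_mul, abs_of_pos Real.two_pi_pos] at h2
  linarith

theorem loglog_act_loopOne {k : ℤ} (hk : k ≠ 0) (x : Cover) :
    loglog k (x.act loopOne) = loglog k x := by
  have hk1 : (1 : ℝ) ≤ |(k : ℝ)| := by
    rw [← Int.cast_abs]; exact_mod_cast Int.one_le_abs hk
  have := loglog_act isLogAlong_loopOne (m := 0) (by rw [logLoopOne_one]; simp) (k := k) (n := 0)
    (u := fun t ↦ logPos (logLoopOne t + 2 * (Real.pi : ℂ) * Complex.I * (k : ℂ)))
    ⟨?_, rfl, fun t ↦ exp_logPos (isLogAlong_loopOne.add_ne_zero k t)⟩ ?_ x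
  · simpa using this
  · have := isLogAlong_loopOne.continuous
    exact (Continuous.clog (by fun_prop) fun t ↦ neg_add_mem_slitPlane_of_norm
      (by nlinarith [norm_logLoopOne_le t, Real.pi_gt_three])).add continuous_const
  · simp [logLoopOne_one]

theorem M_act_loopZero (α : ℂ) (k : ℤ) (x : Cover) : M α k (x.act loopZero) = M α (k + 1) x := by
  rw [M, M, loglog_act_loopZero]

theorem M_zero_act_loopOne (α : ℂ) (x : Cover) : M α 0 (x.act loopOne) =
    Complex.exp (2 * (Real.pi : ℂ) * Complex.I * α) * M α 0 x := by
  rw [M, M, loglog_zero_act_loopOne,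
    show (α - 1) * (loglog 0 x + 2 * (Real.pi : ℂ) * Complex.I) = (α - 1) * loglog 0 x +
      (2 * (Real.pi : ℂ) * Complex.I * α - 2 * (Real.pi : ℂ) * Complex.I) by ring,
    Complex.exp_add, Complex.exp_sub, Complex.exp_two_pi_mul_I]
  ring

theorem M_act_loopOne (α : ℂ) {k : ℤ} (hk : k ≠ 0) (x : Cover) :
    M α k (x.act loopOne) = M α k x := by
  rw [M, M, loglog_act_loopOne hk]

/-! ### The identity principle on the universal cover -/

theorem Cover.mem_sheet_self (x : Cover) {r : ℝ} (hr : 0 < r) : x ∈ x.sheet r :=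
  ⟨.refl _, fun _ ↦ Metric.mem_ball_self hr, (Path.Homotopic.Quotient.trans_refl _).symm⟩

theorem Cover.sheet_trans {x y z : Cover} {r s : ℝ} (hy : y ∈ x.sheet r) (hz : z ∈ y.sheet s)
    (h : dist (y.pt : ℂ) x.pt + s ≤ r) : z ∈ x.sheet r := by
  obtain ⟨p, hp, hpc⟩ := hy
  obtain ⟨q, hq, hqc⟩ := hz
  refine ⟨p.trans q, fun t ↦ ?_, ?_⟩
  · rw [Path.trans_apply]
    split_ifs
    · exact hp _
    · exact Metric.ball_subset_ball' (by linarith) (hq _)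
  · rw [hqc, hpc, Path.Homotopic.Quotient.trans_assoc]; rfl

theorem Cover.dist_lt_of_mem_sheet {x y : Cover} {r : ℝ} (hy : y ∈ x.sheet r) :
    dist (y.pt : ℂ) x.pt < r := by
  obtain ⟨p, hp, -⟩ := hy
  simpa using hp 1

theorem isOpen_Omega : IsOpen Omega := (Set.toFinite {(0 : ℂ), 1}).isClosed.isOpen_compl

/-- A sheet contains a point over every nearby point of the plane. -/
theorem Cover.exists_mem_sheet (y : Cover) {s : ℝ} (hs : 0 < s) :
    ∀ᶠ z in 𝓝 (y.pt : ℂ), ∃ y' ∈ y.sheet s, (y'.pt : ℂ) = z := by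
  obtain ⟨r, hr, h⟩ := Metric.isOpen_iff.mp isOpen_Omega y.pt y.pt.2
  filter_upwards [Metric.ball_mem_nhds (y.pt : ℂ) (lt_min hr hs)] with z hz
  have hseg : ∀ t : I, AffineMap.lineMap (y.pt : ℂ) z (t : ℝ) ∈
      Metric.ball (y.pt : ℂ) (min r s) := fun t ↦
    (convex_ball _ _).lineMap_mem (Metric.mem_ball_self (lt_min hr hs)) hz t.2
  have hO : ∀ t : I, AffineMap.lineMap (y.pt : ℂ) z (t : ℝ) ∈ Omega := fun t ↦
    h (Metric.ball_subset_ball (min_le_left _ _) (hseg t))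
  have hz' : z ∈ Omega := by simpa using hO 1
  let p : Path y.pt ⟨z, hz'⟩ :=
    ⟨⟨fun t ↦ ⟨AffineMap.lineMap (y.pt : ℂ) z (t : ℝ), hO t⟩, by
      refine Continuous.subtype_mk ?_ _
      exact AffineMap.lineMap_continuous.comp continuous_subtype_val⟩,
      Subtype.ext (by simp), Subtype.ext (by simp)⟩
  exact ⟨⟨⟨z, hz'⟩, y.cls.trans (.mk p)⟩,
    ⟨p, fun t ↦ Metric.ball_subset_ball (min_le_right _ _) (hseg t), rfl⟩, rfl⟩

/-- The point of the universal cover given by the initial piece of a path. -/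
def Cover.initial {z : Omega} (c : Path base z) (t : I) : Cover :=
  ⟨c t, .mk ((c.subpath 0 t).cast c.source.symm rfl)⟩

theorem Cover.continuous_initial {z : Omega} (c : Path base z) : Continuous (Cover.initial c) := by
  refine continuous_def.mpr fun S hS ↦ isOpen_iff_mem_nhds.mpr fun t₀ ht₀ ↦ ?_
  obtain ⟨r, hr, h⟩ := hS _ ht₀
  have hc : ContinuousAt (fun t : I ↦ (c t : ℂ)) t₀ := by fun_prop
  obtain ⟨δ, hδ, hcδ⟩ := Metric.continuousAt_iff.mp hc r hr
  filter_upwards [Metric.ball_mem_nhds t₀ hδ] with t ht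
  refine h ⟨c.subpath t₀ t, fun s ↦ ?_, ?_⟩
  · refine hcδ (lt_of_le_of_lt ?_ (Metric.mem_ball.mp ht))
    rw [Subtype.dist_eq, Subtype.dist_eq, Set.Icc.coe_convexComb, Real.dist_eq, Real.dist_eq,
      show (1 - (s : ℝ)) * t₀ + s * t - t₀ = s * (t - t₀) by ring, abs_mul, abs_of_nonneg s.2.1]
    exact mul_le_of_le_one_left (abs_nonneg _) s.2.2
  · exact Eq.symm (Path.Homotopic.Quotient.eq.mpr
      ⟨(Path.Homotopy.subpathTransSubpath c 0 t₀ t).pathCast c.source.symm rfl⟩)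

theorem Cover.mk_eq_mk {z w : Omega} (h : z = w) {c : Path base z} {d : Path base w}
    (hcd : ∀ t, c t = d t) : (⟨z, .mk c⟩ : Cover) = ⟨w, .mk d⟩ := by
  subst h
  rw [show c = d from Path.ext (funext hcd)]

theorem Cover.initial_zero {z : Omega} (c : Path base z) : Cover.initial c 0 = Cover.basePt :=
  Cover.mk_eq_mk (d := .refl base) c.source fun t ↦ by simp

theorem Cover.initial_one {z : Omega} (c : Path base z) : Cover.initial c 1 = ⟨z, .mk c⟩ :=
  Cover.mk_eq_mk c.target fun t ↦ by simp

instance : PreconnectedSpace Cover := by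
  refine preconnectedSpace_of_forall_constant fun f hf x y ↦ ?_
  suffices ∀ x, f x = f Cover.basePt by rw [this, this y]
  intro x
  obtain ⟨c, hc, -⟩ := x.exists_path
  rw [hc, ← Cover.initial_one, ← Cover.initial_zero c]
  exact PreconnectedSpace.constant inferInstance (hf.comp (Cover.continuous_initial c))

/-- Identity principle: a multivalued analytic function is determined by its germ at the base
point. -/
theorem IsMultivaluedAnalytic.eq_of_germ {F G : Cover → ℂ} (hF : IsMultivaluedAnalytic F)
    (hG : IsMultivaluedAnalytic G) {r : ℝ} (hr : 0 < r)
    (h : ∀ y ∈ Cover.basePt.sheet r, F y = G y) : F = G := by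
  let S : Set Cover := {x | ∃ r > (0 : ℝ), ∀ y ∈ x.sheet r, F y = G y}
  have hS : IsOpen S := fun x ⟨r, hr, hx⟩ ↦ ⟨r, hr, fun y hy ↦
    ⟨r - dist (y.pt : ℂ) x.pt, sub_pos.mpr (Cover.dist_lt_of_mem_sheet hy),
      fun z hz ↦ hx z (Cover.sheet_trans hy hz (by linarith))⟩⟩
  have hS' : IsOpen Sᶜ := by
    intro x hx
    obtain ⟨f, hf, r, hr, hfr⟩ := hF x
    obtain ⟨g, hg, s, hs, hgs⟩ := hG x
    obtain ⟨ρ, hρ, hfg⟩ := Metric.eventually_nhds_iff_ball.mp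
      (hf.eventually_analyticAt.and hg.eventually_analyticAt)
    have hR : 0 < min ρ (min r s) := lt_min hρ (lt_min hr hs)
    have hFf : ∀ y ∈ x.sheet (min ρ (min r s)), F y = f y.pt := fun y hy ↦
      hfr y (Cover.sheet_mono _ ((min_le_right _ _).trans (min_le_left _ _)) hy)
    have hGg : ∀ y ∈ x.sheet (min ρ (min r s)), G y = g y.pt := fun y hy ↦
      hgs y (Cover.sheet_mono _ ((min_le_right _ _).trans (min_le_right _ _)) hy)
    refine ⟨_, hR, fun y hy ⟨q, hq, hyq⟩ ↦ hx ⟨_, hR, fun z hz ↦ ?_⟩⟩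
    have hev : f =ᶠ[𝓝 (y.pt : ℂ)] g := by
      filter_upwards [y.exists_mem_sheet
        (lt_min hq (sub_pos.mpr (Cover.dist_lt_of_mem_sheet hy)))] with z ⟨y', hy', hz⟩
      have h1 := Cover.sheet_trans hy (Cover.sheet_mono _ (min_le_right _ _) hy') (by linarith)
      rw [← hz, ← hFf y' h1, ← hGg y' h1]
      exact hyq _ (Cover.sheet_mono _ (min_le_left _ _) hy')
    have heq := AnalyticOnNhd.eqOn_of_preconnected_of_eventuallyEq
      (f := f) (g := g) (U := Metric.ball (x.pt : ℂ) ρ) (fun z hz ↦ (hfg z hz).1)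
      (fun z hz ↦ (hfg z hz).2) (convex_ball _ _).isPreconnected
      (z₀ := (y.pt : ℂ)) ((Cover.dist_lt_of_mem_sheet hy).trans_le (min_le_left _ _)) hev
    rw [hFf z hz, hGg z hz]
    exact heq ((Cover.dist_lt_of_mem_sheet hz).trans_le (min_le_left _ _))
  have huniv : S = Set.univ := IsClopen.eq_univ ⟨⟨hS'⟩, hS⟩ ⟨Cover.basePt, r, hr, h⟩
  ext x
  obtain ⟨r, hr, hx⟩ : x ∈ S := huniv ▸ trivial
  exact hx x (x.mem_sheet_self hr)

theorem IsAnalyticContinuation.unique {f : ℂ → ℂ} {F G : Cover → ℂ}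
    (hF : IsAnalyticContinuation f F) (hG : IsAnalyticContinuation f G) : F = G := by
  obtain ⟨hF, r, hr, h⟩ := hF
  obtain ⟨hG, s, hs, h'⟩ := hG
  refine hF.eq_of_germ hG (lt_min hr hs) fun y hy ↦ ?_
  rw [h y (Cover.sheet_mono _ (min_le_left _ _) hy),
    h' y (Cover.sheet_mono _ (min_le_right _ _) hy)]

theorem IsMultivaluedAnalytic.act {F : Cover → ℂ} (hF : IsMultivaluedAnalytic F)
    (g : Path base base) : IsMultivaluedAnalytic fun x ↦ F (x.act g) := fun x ↦ by
  obtain ⟨f, hf, r, hr, h⟩ := hF (x.act g)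
  refine ⟨f, hf, r, hr, fun y ⟨p, hp, hyp⟩ ↦ h (y.act g) ⟨p, hp, ?_⟩⟩
  simp only [Cover.act, hyp, Path.Homotopic.Quotient.trans_assoc]

/-! ### Euler's integral with a complex parameter -/

/-- Laplace integrals may be differentiated under the integral sign. -/
theorem hasDerivAt_integral_exp {φ : ℝ → ℂ} {S : Set ℝ} (hS : MeasurableSet S)
    (hS0 : S ⊆ Set.Ioi 0) (hφ : AEStronglyMeasurable φ (volume.restrict S)) {c : ℝ} {w₀ : ℂ}
    (hc : c < w₀.re) (h0 : IntegrableOn (fun x ↦ ‖φ x‖ * Real.exp (-c * x)) S)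
    (h1 : IntegrableOn (fun x ↦ x * ‖φ x‖ * Real.exp (-c * x)) S) :
    HasDerivAt (fun w : ℂ ↦ ∫ x in S, φ x * Complex.exp (-(w * x)))
      (∫ x in S, -(x * φ x * Complex.exp (-(w₀ * x)))) w₀ := by
  have hnorm : ∀ w : ℂ, c < w.re → ∀ x ∈ S,
      ‖Complex.exp (-(w * x))‖ ≤ Real.exp (-c * x) := fun w hw x hx ↦ by
    rw [Complex.norm_exp, Complex.neg_re, Complex.re_mul_ofReal]
    have : 0 < x := hS0 hx
    exact Real.exp_le_exp.mpr (by nlinarith)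
  refine (hasDerivAt_integral_of_dominated_loc_of_deriv_le (𝕜 := ℂ)
    (F := fun (w : ℂ) x ↦ φ x * Complex.exp (-(w * x)))
    (F' := fun (w : ℂ) x ↦ -(x * φ x * Complex.exp (-(w * x)))) (s := {w : ℂ | c < w.re})
    (bound := fun x ↦ x * ‖φ x‖ * Real.exp (-c * x))
    ((isOpen_lt continuous_const Complex.continuous_re).mem_nhds hc) ?_ ?_ ?_ ?_ h1 ?_).2
  · exact Eventually.of_forall fun w ↦ hφ.mul (by fun_prop)
  · refine h0.mono' (hφ.mul (by fun_prop)) ?_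
    filter_upwards [ae_restrict_mem hS] with x hx
    rw [norm_mul]
    exact mul_le_mul_of_nonneg_left (hnorm w₀ hc x hx) (norm_nonneg _)
  · have : AEStronglyMeasurable (fun x : ℝ ↦ (x : ℂ)) (volume.restrict S) := by fun_prop
    exact ((this.mul hφ).mul (by fun_prop)).neg
  · filter_upwards [ae_restrict_mem hS] with x hx w hw
    have h := hnorm w hw x hx
    have hx0 : 0 < x := hS0 hx
    rw [norm_neg, norm_mul, norm_mul, Complex.norm_real, Real.norm_of_nonneg hx0.le]
    gcongr
  · filter_upwards with x w hw
    have h : HasDerivAt (fun w : ℂ ↦ -(w * x)) (-(1 * (x : ℂ))) w :=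
      ((hasDerivAt_id w).mul_const _).neg
    convert! h.cexp.const_mul (φ x) using 1
    ring

theorem integrableOn_rpow_mul_exp {s b : ℝ} (hs : -1 < s) (hb : 0 < b) :
    IntegrableOn (fun x : ℝ ↦ x ^ s * Real.exp (-b * x)) (Set.Ioi 0) := by
  simpa using integrableOn_rpow_mul_exp_neg_mul_rpow hs one_pos hb

/-- Euler's integral for `Γ`, with a complex scaling parameter. -/
theorem integral_cpow_mul_exp_neg_mul_complex {a w : ℂ} (ha : 0 < a.re) (hw : 0 < w.re) :
    ∫ x in Set.Ioi (0 : ℝ), (x : ℂ) ^ (a - 1) * Complex.exp (-(w * x)) =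
      Complex.exp (-a * Complex.log w) * Complex.Gamma a := by
  let U : Set ℂ := {w | 0 < w.re}
  have hU : IsOpen U := isOpen_lt continuous_const Complex.continuous_re
  have hnorm : ∀ x ∈ Set.Ioi (0 : ℝ), ‖(x : ℂ) ^ (a - 1)‖ = x ^ (a.re - 1) := fun x hx ↦ by
    rw [Complex.norm_cpow_eq_rpow_re_of_pos hx]; simp
  have hmeas : AEStronglyMeasurable (fun x : ℝ ↦ (x : ℂ) ^ (a - 1))
      (volume.restrict (Set.Ioi 0)) := by
    refine ContinuousOn.aestronglyMeasurable (fun x hx ↦ ?_) measurableSet_Ioi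
    exact (Complex.continuousAt_ofReal_cpow_const x _ (.inr (ne_of_gt hx))).continuousWithinAt
  have hF : DifferentiableOn ℂ
      (fun w : ℂ ↦ ∫ x in Set.Ioi (0 : ℝ), (x : ℂ) ^ (a - 1) * Complex.exp (-(w * x))) U := by
    intro z (hz : 0 < z.re)
    refine (hasDerivAt_integral_exp measurableSet_Ioi subset_rfl hmeas (c := z.re / 2)
      (by linarith) ?_ ?_).differentiableAt.differentiableWithinAt
    · refine (integrableOn_rpow_mul_exp (s := a.re - 1) (b := z.re / 2) (by linarith)
        (by linarith)).congr_fun (fun x hx ↦ ?_) measurableSet_Ioi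
      simp only [hnorm x hx]
    · refine (integrableOn_rpow_mul_exp (s := a.re) (b := z.re / 2) (by linarith)
        (by linarith)).congr_fun (fun x hx ↦ ?_) measurableSet_Ioi
      simp only [hnorm x hx]
      rw [← Real.rpow_one_add' (le_of_lt hx) (by linarith), add_sub_cancel]
  have hG : DifferentiableOn ℂ
      (fun w : ℂ ↦ Complex.exp (-a * Complex.log w) * Complex.Gamma a) U := fun z hz ↦ by
    have : DifferentiableAt ℂ Complex.log z := Complex.differentiableAt_log (.inl hz)
    exact DifferentiableAt.differentiableWithinAt (by fun_prop)
  -- For real `w` the formula is known, and the points `1 + 1/(n+1)` accumulate at `1`.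
  have hfreq : ∃ᶠ z in 𝓝[≠] (1 : ℂ),
      ∫ x in Set.Ioi (0 : ℝ), (x : ℂ) ^ (a - 1) * Complex.exp (-(z * x)) =
        Complex.exp (-a * Complex.log z) * Complex.Gamma a := by
    have ht : Tendsto (fun n : ℕ ↦ ((1 + 1 / ((n : ℝ) + 1) : ℝ) : ℂ)) atTop (𝓝[≠] (1 : ℂ)) := by
      refine tendsto_nhdsWithin_iff.mpr ⟨?_, .of_forall fun n h ↦ ?_⟩
      · have := (tendsto_one_div_add_atTop_nhds_zero_nat (𝕜 := ℝ)).const_add 1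
        rw [add_zero] at this
        simpa [Function.comp_def] using (Complex.continuous_ofReal.tendsto _).comp this
      · have h1 : (1 + 1 / ((n : ℝ) + 1) : ℝ) = 1 :=
          Complex.ofReal_injective (h.trans Complex.ofReal_one.symm)
        have : 0 < 1 / ((n : ℝ) + 1) := by positivity
        linarith
    refine ht.frequently (Frequently.of_forall fun n ↦ ?_)
    have hr : 0 < 1 + 1 / ((n : ℝ) + 1) := by positivity
    rw [Complex.integral_cpow_mul_exp_neg_mul_Ioi ha hr, Complex.cpow_def_of_ne_zero
      (one_div_ne_zero (Complex.ofReal_ne_zero.mpr hr.ne')), one_div, Complex.log_inv]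
    · congr 2; ring
    · rw [Complex.arg_ofReal_of_nonneg hr.le]; exact Real.pi_pos.ne
  exact AnalyticOnNhd.eqOn_of_preconnected_of_frequently_eq (hF.analyticOnNhd hU)
    (hG.analyticOnNhd hU) (convex_halfSpace_re_gt 0).isPreconnected
    (by simp [U] : (1 : ℂ) ∈ U) hfreq hw

/-! ### Branch terms and their majorants -/

/-- The branch of `C_α (w + 2πik)^{α - 1}` with `0 < arg < 2π`. -/
def branchTerm (α : ℂ) (k : ℤ) (w : ℂ) : ℂ :=
  C α * powPos (w + 2 * (Real.pi : ℂ) * Complex.I * (k : ℂ)) (α - 1)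

theorem norm_powPos_le {q : ℂ} (hq : q ≠ 0) (s : ℂ) :
    ‖powPos q s‖ ≤ Real.exp (2 * Real.pi * |s.im|) * ‖q‖ ^ s.re := by
  have h1 : (logPos q).re = Real.log ‖q‖ := by
    simp [logPos, Complex.log_re]
  have h2 : |(logPos q).im| ≤ 2 * Real.pi := by
    have : (logPos q).im = Complex.arg (-q) + Real.pi := by simp [logPos, Complex.log_im]
    rw [this, abs_le]
    constructor <;> linarith [Complex.arg_le_pi (-q), Complex.neg_pi_lt_arg (-q), Real.pi_pos]
  rw [powPos, Complex.norm_exp, Complex.mul_re, h1, Real.rpow_def_of_pos (norm_pos_iff.mpr hq),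
    ← Real.exp_add]
  refine Real.exp_le_exp.mpr ?_
  have h3 : -(s.im * (logPos q).im) ≤ |s.im| * (2 * Real.pi) :=
    (neg_le_abs _).trans (by rw [abs_mul]; gcongr)
  linarith

/-- The terms `C_α (w + 2πik)^{α - 1}` with `|k| > N`. -/
def tailTerm (α : ℂ) (N : ℕ) (k : ℤ) (w : ℂ) : ℂ :=
  if |k| ≤ N then 0 else branchTerm α k w

/-- The majorants of the tail terms. -/
def tailBound (α : ℂ) (c : ℝ) (k : ℤ) : ℝ :=
  ‖C α‖ * (Real.exp (2 * Real.pi * |α.im|) * (c ^ (α.re - 1) * |(k : ℝ)| ^ (-(1 - α.re))))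

theorem summable_tailBound {α : ℂ} (hα : α.re < 0) (c : ℝ) : Summable (tailBound α c) :=
  (((Real.summable_abs_int_rpow (by linarith)).mul_left _).mul_left _).mul_left _

theorem norm_tailTerm_le {α : ℂ} (hα : α.re < 0) {N : ℕ} {c : ℝ} (hc : 0 < c) {w : ℂ}
    (hw : ∀ k : ℤ, (N : ℤ) < |k| →
      c * |(k : ℝ)| ≤ ‖w + 2 * (Real.pi : ℂ) * Complex.I * (k : ℂ)‖) (k : ℤ) :
    ‖tailTerm α N k w‖ ≤ tailBound α c k := by
  rw [tailTerm, tailBound]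
  split_ifs with h
  · rw [norm_zero]; positivity
  · rw [not_le] at h
    have hk : 0 < |(k : ℝ)| := by
      rw [← Int.cast_abs]; exact_mod_cast (Int.natCast_nonneg N).trans_lt h
    have h1 := hw k h
    have h2 : 0 < ‖w + 2 * (Real.pi : ℂ) * Complex.I * (k : ℂ)‖ :=
      (mul_pos hc hk).trans_le h1
    rw [branchTerm, norm_mul]
    refine mul_le_mul_of_nonneg_left ((norm_powPos_le (norm_pos_iff.mp h2) _).trans ?_)
      (norm_nonneg _)
    rw [Complex.sub_im, Complex.one_im, sub_zero, Complex.sub_re, Complex.one_re, neg_sub]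
    gcongr
    rw [← Real.mul_rpow hc.le hk.le]
    exact Real.rpow_le_rpow_of_nonpos (mul_pos hc hk) h1 (by linarith)

theorem le_norm_add_of_abs_im_le {w : ℂ} (hw : |w.im| ≤ Real.pi) (k : ℤ) :
    1 * |(k : ℝ)| ≤ ‖w + 2 * (Real.pi : ℂ) * Complex.I * (k : ℂ)‖ := by
  rcases eq_or_ne k 0 with rfl | hk
  · simp
  have hk1 : (1 : ℝ) ≤ |(k : ℝ)| := by
    rw [← Int.cast_abs]; exact_mod_cast Int.one_le_abs hk
  refine le_trans ?_ (Complex.abs_im_le_norm _)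
  have him : (w + 2 * (Real.pi : ℂ) * Complex.I * (k : ℂ)).im = w.im + 2 * Real.pi * k := by simp
  have h2 := abs_sub_abs_le_abs_sub (2 * Real.pi * k) (-w.im)
  rw [abs_mul, abs_of_pos Real.two_pi_pos, abs_neg, sub_neg_eq_add, add_comm] at h2
  rw [him]
  nlinarith [Real.pi_gt_three]

/-- The radius of a disc around `0` that contains `-log 2` and meets none of the rays
`-2πik + [0, ∞)` with `|k| > N`. -/
def rad (N : ℕ) : ℝ := 2 * Real.pi * N + 1

theorem le_norm_add_of_mem_ball {N : ℕ} {w : ℂ} (hw : w ∈ Metric.ball 0 (rad N)) {k : ℤ}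
    (hk : (N : ℤ) < |k|) :
    ((N : ℝ) + 1)⁻¹ * |(k : ℝ)| ≤ ‖w + 2 * (Real.pi : ℂ) * Complex.I * (k : ℂ)‖ := by
  have hk1 : (N : ℝ) + 1 ≤ |(k : ℝ)| := by
    rw [← Int.cast_abs]; exact_mod_cast Int.add_one_le_of_lt hk
  have hw' : ‖w‖ < 2 * Real.pi * N + 1 := mem_ball_zero_iff.mp hw
  have h1 : ‖2 * (Real.pi : ℂ) * Complex.I * (k : ℂ)‖ = 2 * Real.pi * |(k : ℝ)| := by
    simp [Real.pi_pos.le]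
  have h2 := norm_sub_le_norm_add (2 * (Real.pi : ℂ) * Complex.I * (k : ℂ)) w
  rw [h1, add_comm] at h2
  refine le_trans ?_ h2
  have hN : (0 : ℝ) ≤ N := N.cast_nonneg
  rw [inv_mul_le_iff₀ (by positivity)]
  have h3 : |(k : ℝ)| - N ≤ 2 * Real.pi * |(k : ℝ)| - ‖w‖ := by
    nlinarith [Real.pi_gt_three]
  nlinarith

theorem tendstoUniformlyOn_tailTerm {α : ℂ} (hα : α.re < 0) {N : ℕ} {c : ℝ} (hc : 0 < c)
    {S : Set ℂ} (hS : ∀ w ∈ S, ∀ k : ℤ, (N : ℤ) < |k| →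
      c * |(k : ℝ)| ≤ ‖w + 2 * (Real.pi : ℂ) * Complex.I * (k : ℂ)‖) :
    TendstoUniformlyOn (fun (n : ℕ) w ↦ ∑ k ∈ Finset.Icc (-(n : ℤ)) n, tailTerm α N k w)
      (fun w ↦ ∑' k, tailTerm α N k w) atTop S := by
  have h := tendstoUniformlyOn_tsum (summable_tailBound hα c)
    fun k w hw ↦ norm_tailTerm_le hα hc (hS w hw) k
  have ht : Tendsto (fun n : ℕ ↦ Finset.Icc (-(n : ℤ)) n) atTop atTop := by
    refine tendsto_atTop_finset_of_monotone (fun m n hmn ↦ Finset.Icc_subset_Icc (by omega)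
      (by omega)) fun k ↦ ⟨k.natAbs, Finset.mem_Icc.mpr (by omega)⟩
  exact fun u hu ↦ ht.eventually (h u hu)

/-- The partial sums with `|k| ≤ n` split off the terms with `|k| ≤ N`. -/
theorem sum_branchTerm_eq {N n : ℕ} (h : N ≤ n) (α w : ℂ) :
    ∑ k ∈ Finset.Icc (-(n : ℤ)) n, branchTerm α k w =
      ∑ k ∈ Finset.Icc (-(N : ℤ)) N, branchTerm α k w +
        ∑ k ∈ Finset.Icc (-(n : ℤ)) n, tailTerm α N k w := by
  have hsub : Finset.Icc (-(N : ℤ)) N ⊆ Finset.Icc (-(n : ℤ)) n :=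
    Finset.Icc_subset_Icc (by omega) (by omega)
  rw [← Finset.sum_sdiff hsub, add_comm, ← Finset.sum_sdiff (f := fun k ↦ tailTerm α N k w) hsub]
  congr 1
  rw [Finset.sum_eq_zero (s := Finset.Icc (-(N : ℤ)) N), add_zero]
  · refine Finset.sum_congr rfl fun k hk ↦ ?_
    rw [Finset.mem_sdiff, Finset.mem_Icc, Finset.mem_Icc] at hk
    rw [tailTerm, if_neg]
    rw [abs_le]; exact hk.2
  · intro k hk
    rw [tailTerm, if_pos (abs_le.mpr (Finset.mem_Icc.mp hk))]

/-! ### Lipschitz's formula -/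

/-- The function `x^{-α} e^{wx}` on `x > 0`, extended by `0`, to which Poisson summation is
applied. -/
def poissonFun (α w : ℂ) (x : ℝ) : ℂ := ((max x 0 : ℝ) : ℂ) ^ (-α) * Complex.exp (w * x)

theorem poissonFun_of_pos (α w : ℂ) {x : ℝ} (hx : 0 < x) :
    poissonFun α w x = (x : ℂ) ^ (-α) * Complex.exp (w * x) := by
  rw [poissonFun, max_eq_left hx.le]

theorem poissonFun_of_nonpos {α : ℂ} (hα : α.re < 0) (w : ℂ) {x : ℝ} (hx : x ≤ 0) :
    poissonFun α w x = 0 := by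
  have : -α ≠ 0 := fun h ↦ by rw [neg_eq_zero.mp h] at hα; simp at hα
  rw [poissonFun, max_eq_right hx, Complex.ofReal_zero, Complex.zero_cpow this, zero_mul]

theorem continuous_poissonFun {α : ℂ} (hα : α.re < 0) (w : ℂ) : Continuous (poissonFun α w) := by
  have h : Continuous fun x : ℝ ↦ (x : ℂ) ^ (-α) := continuous_iff_continuousAt.mpr fun x ↦
    Complex.continuousAt_ofReal_cpow_const x _ (.inl (by simpa using hα))
  exact (h.comp (by fun_prop : Continuous fun x : ℝ ↦ max x 0)).mul (by fun_prop)

theorem poissonFun_isBigO {α : ℂ} (hα : α.re < 0) {w : ℂ} (hw : w.re < 0) :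
    poissonFun α w =O[cocompact ℝ] fun x : ℝ ↦ |x| ^ (-2 : ℝ) := by
  rw [cocompact_eq_atBot_atTop, Asymptotics.isBigO_sup]
  constructor
  · refine Asymptotics.IsBigO.of_bound 0 ?_
    filter_upwards [eventually_le_atBot 0] with x hx
    rw [poissonFun_of_nonpos hα w hx]; simp
  · have h := ((Asymptotics.isBigO_refl (fun x : ℝ ↦ x ^ (-α.re)) atTop).mul
      (isLittleO_exp_neg_mul_rpow_atTop (neg_pos.mpr hw) (-2 + α.re)).isBigO)
    refine (Asymptotics.IsBigO.congr' (h.norm_left) ?_ ?_).of_norm_left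
    · filter_upwards [eventually_gt_atTop 0] with x hx
      rw [poissonFun_of_pos α w hx, norm_mul, norm_mul,
        Complex.norm_cpow_eq_rpow_re_of_pos hx, Complex.norm_exp, Complex.re_mul_ofReal,
        Real.norm_of_nonneg (Real.rpow_nonneg hx.le _), Real.norm_of_nonneg (Real.exp_pos _).le,
        neg_neg, Complex.neg_re]
    · filter_upwards [eventually_gt_atTop 0] with x hx
      rw [abs_of_pos hx, ← Real.rpow_add hx]
      congr 1; ring

/-- The factor `e^{πi(-α-1)}` in `C_α` compensates the branch `0 < arg < 2π` of the power. -/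
theorem fourier_poissonFun {α : ℂ} (hα : α.re < 0) {w : ℂ} (hw : w.re < 0) (k : ℤ) :
    FourierTransform.fourier (poissonFun α w) (k : ℝ) = branchTerm α (-k) w := by
  set r : ℂ := -(w + 2 * (Real.pi : ℂ) * Complex.I * ((-k : ℤ) : ℂ)) with hr
  have hre : 0 < r.re := by
    rw [hr]; simpa using hw
  have h1 : FourierTransform.fourier (poissonFun α w) (k : ℝ) =
      ∫ x in Set.Ioi (0 : ℝ), (x : ℂ) ^ ((1 - α) - 1) * Complex.exp (-(r * x)) := by
    rw [Real.fourier_real_eq_integral_exp_smul, ← setIntegral_eq_integral_of_forall_compl_eq_zero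
      (s := Set.Ioi (0 : ℝ))]
    · refine setIntegral_congr_fun measurableSet_Ioi fun x hx ↦ ?_
      rw [poissonFun_of_pos α w hx, smul_eq_mul, mul_left_comm, ← Complex.exp_add,
        show (1 - α) - 1 = -α by ring, hr]
      congr 2
      push_cast; ring
    · intro x hx
      rw [poissonFun_of_nonpos hα w (not_lt.mp hx), smul_zero]
  rw [h1, integral_cpow_mul_exp_neg_mul_complex (by simp; linarith) hre, branchTerm, powPos, C,
    logPos, ← hr]
  have h2 : Complex.exp ((Real.pi : ℂ) * Complex.I * (-α - 1)) *
      Complex.exp ((α - 1) * (Complex.log r + (Real.pi : ℂ) * Complex.I)) =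
        Complex.exp (-(1 - α) * Complex.log r) := by
    rw [← Complex.exp_add, show (Real.pi : ℂ) * Complex.I * (-α - 1) +
      (α - 1) * (Complex.log r + (Real.pi : ℂ) * Complex.I) =
        -(1 - α) * Complex.log r - 2 * (Real.pi : ℂ) * Complex.I by ring,
      Complex.exp_sub, Complex.exp_two_pi_mul_I, div_one]
  rw [← h2]; ring

theorem exists_mem_ball_rad (w : ℂ) : ∃ N, w ∈ Metric.ball 0 (rad N) := by
  obtain ⟨N, hN⟩ := exists_nat_gt ‖w‖
  refine ⟨N, mem_ball_zero_iff.mpr ?_⟩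
  rw [rad]
  nlinarith [Real.pi_gt_three, norm_nonneg w]

theorem summable_branchTerm {α : ℂ} (hα : α.re < 0) (w : ℂ) :
    Summable fun k ↦ branchTerm α k w := by
  obtain ⟨N, hN⟩ := exists_mem_ball_rad w
  have h : Summable fun k ↦ tailTerm α N k w :=
    .of_norm_bounded (summable_tailBound hα _) fun k ↦
      norm_tailTerm_le hα (inv_pos.mpr N.cast_add_one_pos)
        (fun k hk ↦ le_norm_add_of_mem_ball hN hk) k
  refine h.congr_cofinite ?_
  filter_upwards [(Finset.Icc (-(N : ℤ)) N).finite_toSet.compl_mem_cofinite] with k hk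
  rw [tailTerm, if_neg]
  rw [abs_le]
  simpa using hk

/-- Lipschitz's formula: Poisson summation for `x^{-α} e^{wx}`. -/
theorem polylog_exp_eq_tsum {α : ℂ} (hα : α.re < 0) {w : ℂ} (hw : w.re < 0) :
    polylog α (Complex.exp w) = ∑' k, branchTerm α k w := by
  have hsum : Summable fun k : ℤ ↦ FourierTransform.fourier (poissonFun α w) (k : ℝ) := by
    simp_rw [fourier_poissonFun hα hw]
    exact (Equiv.neg ℤ).summable_iff.mpr (summable_branchTerm hα w)
  have h := Real.tsum_eq_tsum_fourier_of_rpow_decay_of_summable (continuous_poissonFun hα w)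
    (b := 2) one_lt_two (poissonFun_isBigO hα hw) hsum 0
  simp_rw [fourier_poissonFun hα hw, zero_add] at h
  have h2 : ∑' k : ℤ, branchTerm α (-k) w * fourier k ((0 : ℝ) : UnitAddCircle) =
      ∑' k, branchTerm α k w := by
    rw [← (Equiv.neg ℤ).tsum_eq (fun k ↦ branchTerm α k w)]
    simp
  have h3 : Function.Injective fun n : ℕ ↦ (n : ℤ) + 1 := fun m n hmn ↦ by simpa using hmn
  rw [← h2, ← h, ← h3.tsum_eq]
  · refine tsum_congr fun n ↦ ?_
    have hn : (0 : ℝ) < (((n : ℤ) + 1 : ℤ) : ℝ) := by positivity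
    rw [poissonFun_of_pos α w hn, Complex.cpow_neg, ← Complex.exp_nat_mul, div_eq_inv_mul]
    push_cast
    rw [mul_comm w]
  · intro k hk
    by_contra hk'
    refine hk (poissonFun_of_nonpos hα w ?_)
    by_contra! h0
    have h0' : 0 < k := by exact_mod_cast h0
    exact hk' ⟨(k - 1).toNat, by simp only; omega⟩

/-! ### Extension of the remainder -/

theorem hasDerivAt_powPos {q : ℂ} (hq : -q ∈ Complex.slitPlane) (s : ℂ) :
    HasDerivAt (fun q ↦ powPos q s) (s * powPos q (s - 1)) q := by
  have h0 : q ≠ 0 := neg_ne_zero.mp (Complex.slitPlane_ne_zero hq)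
  have h1 : HasDerivAt logPos (-1 / -q) q :=
    ((hasDerivAt_neg q).clog hq).add_const _
  convert! (h1.const_mul s).cexp using 1
  rw [powPos, sub_mul, one_mul, Complex.exp_sub, exp_logPos h0]
  field_simp

theorem C_sub_one {α : ℂ} (hα : α ≠ 1) : C (α - 1) = (α - 1) * C α := by
  rw [C, C, show 1 - (α - 1) = (1 - α) + 1 by ring,
    Complex.Gamma_add_one _ (sub_ne_zero.mpr hα.symm),
    show (Real.pi : ℂ) * Complex.I * (-(α - 1) - 1) =
      (Real.pi : ℂ) * Complex.I * (-α - 1) + (Real.pi : ℂ) * Complex.I by ring,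
    Complex.exp_add, Complex.exp_pi_mul_I]
  ring

theorem hasDerivAt_branchTerm {α : ℂ} (hα : α ≠ 1) {k : ℤ} {w : ℂ}
    (hw : -(w + 2 * (Real.pi : ℂ) * Complex.I * (k : ℂ)) ∈ Complex.slitPlane) :
    HasDerivAt (branchTerm α k) (branchTerm (α - 1) k w) w := by
  have h := ((hasDerivAt_powPos hw (α - 1)).comp_add_const w _).const_mul (C α)
  convert! h using 1
  rw [branchTerm, C_sub_one hα]; ring

theorem differentiableAt_branchTerm (α : ℂ) {k : ℤ} {w : ℂ}
    (hw : -(w + 2 * (Real.pi : ℂ) * Complex.I * (k : ℂ)) ∈ Complex.slitPlane) :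
    DifferentiableAt ℂ (branchTerm α k) w :=
  (((hasDerivAt_powPos hw (α - 1)).comp_add_const w _).const_mul (C α)).differentiableAt

theorem summable_geometric_mul_rpow {ρ : ℝ} (hρ0 : 0 ≤ ρ) (hρ : ρ < 1) (β : ℝ) :
    Summable fun n : ℕ ↦ ρ ^ (n + 1) * ((n + 1 : ℕ) : ℝ) ^ β := by
  have h := (summable_nat_add_iff 1).mpr
    (summable_pow_mul_geometric_of_norm_lt_one (R := ℝ) ⌈β⌉₊ (r := ρ)
      (by rwa [Real.norm_of_nonneg hρ0]))
  refine h.of_nonneg_of_le (fun n ↦ by positivity) fun n ↦ ?_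
  rw [mul_comm, ← Real.rpow_natCast _ ⌈β⌉₊]
  gcongr
  · simp
  · exact Nat.le_ceil β

theorem norm_polylog_term (α : ℂ) (z : ℂ) (n : ℕ) :
    ‖z ^ (n + 1) / ((n + 1 : ℕ) : ℂ) ^ α‖ = ‖z‖ ^ (n + 1) * ((n + 1 : ℕ) : ℝ) ^ (-α.re) := by
  rw [norm_div, norm_pow, Complex.norm_natCast_cpow_of_pos n.succ_pos,
    Real.rpow_neg (Nat.cast_nonneg _), div_eq_mul_inv]

theorem summable_polylog (α : ℂ) {z : ℂ} (hz : ‖z‖ < 1) :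
    Summable fun n : ℕ ↦ z ^ (n + 1) / ((n + 1 : ℕ) : ℂ) ^ α :=
  .of_norm <| by
    simp_rw [norm_polylog_term]
    exact summable_geometric_mul_rpow (norm_nonneg z) hz _

/-- The relation `z Li_α'(z) = Li_{α-1}(z)`, in the variable `log z`. -/
theorem hasDerivAt_polylog_exp (α : ℂ) {w : ℂ} (hw : w.re < 0) :
    HasDerivAt (fun w ↦ polylog α (Complex.exp w)) (polylog (α - 1) (Complex.exp w)) w := by
  have hpos : ∀ n : ℕ, ((n + 1 : ℕ) : ℂ) ≠ 0 := fun n ↦ Nat.cast_ne_zero.mpr n.succ_ne_zero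
  have hexp : Real.exp (w.re / 2) < 1 := Real.exp_lt_one_iff.mpr (by linarith)
  refine hasDerivAt_tsum_of_isPreconnected (t := {v | v.re < w.re / 2}) (y₀ := w)
    (g := fun (n : ℕ) v ↦ Complex.exp v ^ (n + 1) / ((n + 1 : ℕ) : ℂ) ^ α)
    (g' := fun (n : ℕ) v ↦ Complex.exp v ^ (n + 1) / ((n + 1 : ℕ) : ℂ) ^ (α - 1))
    (summable_geometric_mul_rpow (Real.exp_pos _).le hexp (-(α - 1).re))
    (isOpen_lt Complex.continuous_re continuous_const) (convex_halfSpace_re_lt _).isPreconnected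
    (fun n v _ ↦ ?_) (fun n v hv ↦ ?_) (show w.re < w.re / 2 by linarith)
    (summable_polylog α ?_) (show w.re < w.re / 2 by linarith)
  · convert! ((Complex.hasDerivAt_exp v).pow (n + 1)).div_const (((n + 1 : ℕ) : ℂ) ^ α) using 1
    have h0 : ((n + 1 : ℕ) : ℂ) ^ α ≠ 0 := by
      rw [Ne, Complex.cpow_eq_zero_iff]; exact fun h ↦ hpos n h.1
    rw [Complex.cpow_sub _ _ (hpos n), Complex.cpow_one, Nat.add_sub_cancel]
    have := hpos n
    field_simp
    exact pow_succ _ _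
  · rw [norm_polylog_term]
    gcongr
    rw [Complex.norm_exp]
    exact Real.exp_le_exp.mpr (le_of_lt hv)
  · rw [Complex.norm_exp]; exact Real.exp_lt_one_iff.mpr hw

theorem neg_half_mem_ball (N : ℕ) : (-(1 / 2) : ℂ) ∈ Metric.ball 0 (rad N) := by
  rw [mem_ball_zero_iff, norm_neg, rad]
  have : 0 ≤ 2 * Real.pi * N := by positivity
  norm_num
  linarith

theorem neg_add_mem_slitPlane_of_mem_ball {N : ℕ} {k : ℤ} (hk : (N : ℤ) < |k|) {w : ℂ}
    (hw : w ∈ Metric.ball 0 (rad N)) :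
    -(w + 2 * (Real.pi : ℂ) * Complex.I * (k : ℂ)) ∈ Complex.slitPlane := by
  refine neg_add_mem_slitPlane_of_norm ((mem_ball_zero_iff.mp hw).trans_le ?_)
  have hk1 : (N : ℝ) + 1 ≤ |(k : ℝ)| := by
    rw [← Int.cast_abs]; exact_mod_cast Int.add_one_le_of_lt hk
  rw [rad]
  nlinarith [Real.pi_gt_three]

theorem differentiableOn_tsum_tailTerm {α : ℂ} (hα : α.re < 0) (N : ℕ) :
    DifferentiableOn ℂ (fun w ↦ ∑' k, tailTerm α N k w) (Metric.ball 0 (rad N)) := by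
  refine Complex.differentiableOn_tsum_of_summable_norm
    (summable_tailBound hα ((N : ℝ) + 1)⁻¹) (fun k w hw ↦ ?_) Metric.isOpen_ball
    fun k w hw ↦ norm_tailTerm_le hα (inv_pos.mpr N.cast_add_one_pos)
      (fun k hk ↦ le_norm_add_of_mem_ball hw hk) k
  by_cases hk : |k| ≤ N
  · have : tailTerm α N k = fun _ ↦ 0 := funext fun w ↦ if_pos hk
    rw [this]
    exact differentiableWithinAt_const _
  · have : tailTerm α N k = branchTerm α k := funext fun w ↦ if_neg hk
    rw [this]
    exact (differentiableAt_branchTerm α (neg_add_mem_slitPlane_of_mem_ball (not_le.mp hk)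
      hw)).differentiableWithinAt

theorem polylog_exp_eq_tailTerm {α : ℂ} (hα : α.re < 0) {w : ℂ} (hw : w.re < 0) (N : ℕ) :
    polylog α (Complex.exp w) = (∑' k, tailTerm α N k w) +
      ∑ k ∈ Finset.Icc (-(N : ℤ)) N, branchTerm α k w := by
  have h := (summable_branchTerm hα w).sum_add_tsum_subtype_compl (Finset.Icc (-(N : ℤ)) N)
  rw [polylog_exp_eq_tsum hα hw, ← h, add_comm]
  congr 1
  rw [← tsum_subtype_eq_of_support_subset (s := {k | k ∉ Finset.Icc (-(N : ℤ)) N})]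
  · refine tsum_congr fun k ↦ (if_neg ?_).symm
    rw [abs_le, ← Finset.mem_Icc]; exact k.2
  · intro k hk hk'
    exact hk (if_pos (abs_le.mpr (Finset.mem_Icc.mp hk')))

/-- After removing the branch terms with `|k| ≤ N`, the function `Li_α (e^w)` extends from the left
half-plane to a disc around `0` whose radius grows with `N`. For `Re α < 0` the extension is the
rest of Lipschitz's series; the general case follows by taking primitives. -/
theorem exists_remainder (m : ℕ) : ∀ α : ℂ, (∀ n : ℤ, α ≠ n) → α.re < m → ∀ N : ℕ,
    ∃ R : ℂ → ℂ, DifferentiableOn ℂ R (Metric.ball 0 (rad N)) ∧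
      (∀ w ∈ Metric.ball 0 (rad N), w.re < 0 → polylog α (Complex.exp w) =
        R w + ∑ k ∈ Finset.Icc (-(N : ℤ)) N, branchTerm α k w) ∧
      (α.re < 0 → R = fun w ↦ ∑' k, tailTerm α N k w) := by
  induction m with
  | zero =>
    intro α _ hα N
    rw [Nat.cast_zero] at hα
    exact ⟨_, differentiableOn_tsum_tailTerm hα N,
      fun w _ hw ↦ polylog_exp_eq_tailTerm hα hw N, fun _ ↦ rfl⟩
  | succ m ih =>
    intro α hα hm N
    by_cases h0 : α.re < 0
    · exact ⟨_, differentiableOn_tsum_tailTerm h0 N,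
        fun w _ hw ↦ polylog_exp_eq_tailTerm h0 hw N, fun _ ↦ rfl⟩
    obtain ⟨R, hR, hRp, -⟩ := ih (α - 1)
      (fun n h ↦ hα (n + 1) (by push_cast; rw [← h]; ring))
      (by rw [Complex.sub_re, Complex.one_re]; push_cast at hm; linarith) N
    obtain ⟨G, hG⟩ := hR.isExactOn_ball
    have h1 : α ≠ 1 := by simpa using hα 1
    let U : Set ℂ := Metric.ball 0 (rad N) ∩ {w | w.re < 0}
    have hU : IsOpen U := Metric.isOpen_ball.inter isOpen_re_neg
    have hUc : IsPreconnected U :=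
      ((convex_ball _ _).inter (convex_halfSpace_re_lt 0)).isPreconnected
    let D : ℂ → ℂ := fun w ↦ polylog α (Complex.exp w) -
      ∑ k ∈ Finset.Icc (-(N : ℤ)) N, branchTerm α k w - G w
    have hD : ∀ w ∈ U, HasDerivAt D 0 w := fun w hw ↦ by
      have h2 := ((hasDerivAt_polylog_exp α hw.2).sub (HasDerivAt.fun_sum
        (u := Finset.Icc (-(N : ℤ)) N) fun k _ ↦
          hasDerivAt_branchTerm h1 (neg_add_mem_slitPlane hw.2 k))).sub (hG w hw.1)
      convert! h2 using 1
      rw [hRp w hw.1 hw.2]; ring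
    have hp : (-(1 / 2) : ℂ) ∈ U := ⟨neg_half_mem_ball N, by simp⟩
    refine ⟨fun w ↦ G w + D (-(1 / 2)), fun w hw ↦
      ((hG w hw).add_const _).differentiableAt.differentiableWithinAt, fun w hw hw0 ↦ ?_,
      fun h ↦ absurd h h0⟩
    have h3 : D w = D (-(1 / 2)) := hU.is_const_of_deriv_eq_zero hUc
      (fun v hv ↦ (hD v hv).differentiableAt.differentiableWithinAt)
      (fun v hv ↦ (hD v hv).deriv) ⟨hw, hw0⟩ hp
    simp only [← h3, D]
    ring

/-! ### The continuation of the polylogarithm -/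

theorem IsMultivaluedAnalytic.add {F G : Cover → ℂ} (hF : IsMultivaluedAnalytic F)
    (hG : IsMultivaluedAnalytic G) : IsMultivaluedAnalytic fun x ↦ F x + G x := fun x ↦ by
  obtain ⟨f, hf, r, hr, hfr⟩ := hF x
  obtain ⟨g, hg, s, hs, hgs⟩ := hG x
  refine ⟨fun z ↦ f z + g z, hf.add hg, min r s, lt_min hr hs, fun y hy ↦ ?_⟩
  beta_reduce
  rw [hfr y (Cover.sheet_mono _ (min_le_left _ _) hy),
    hgs y (Cover.sheet_mono _ (min_le_right _ _) hy)]

theorem isMultivaluedAnalytic_sum_M (α : ℂ) (s : Finset ℤ) :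
    IsMultivaluedAnalytic fun x ↦ ∑ k ∈ s, M α k x := by
  induction s using Finset.induction_on with
  | empty => exact fun x ↦ ⟨fun _ ↦ 0, analyticAt_const, 1, one_pos, fun y _ ↦ by simp⟩
  | insert k s hk ih =>
    simp_rw [Finset.sum_insert hk]
    exact (isMultivaluedAnalytic_M α k).add ih

theorem isOpen_reach {S : Set ℂ} (hS : IsOpen S) : IsOpen (reach S) :=
  fun _ hx ↦ exists_sheet_subset_reach hS hx

theorem M_eq_branchTerm (α : ℂ) {S : Set ℂ} {k : ℤ}
    (hS : ∀ w ∈ S, -(w + 2 * (Real.pi : ℂ) * Complex.I * (k : ℂ)) ∈ Complex.slitPlane)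
    {x : Cover} (hx : x ∈ reach S) : M α k x = branchTerm α k (logCover x) := by
  rw [M, loglog_eq_logPos hS hx, branchTerm, powPos]

theorem rad_mono : Monotone rad := fun m n h ↦ by
  unfold rad
  have : (m : ℝ) ≤ n := by exact_mod_cast h
  gcongr

theorem exists_mem_reach_rad (x : Cover) : ∃ N, x ∈ reach (Metric.ball 0 (rad N)) := by
  obtain ⟨r, hr⟩ := exists_mem_reach_ball x
  obtain ⟨N, hN⟩ := exists_nat_gt r
  refine ⟨N, reach_mono (Metric.ball_subset_ball ?_) hr⟩
  have : (0 : ℝ) ≤ N := N.cast_nonneg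
  rw [rad]
  nlinarith [Real.pi_gt_three]

/-- For a point reached inside the disc of radius `rad N`, the functions `M_α[k]` with `|k| > N` are
given by the plain branches. -/
theorem sum_M_eq (α : ℂ) {N n : ℕ} (h : N ≤ n) {x : Cover}
    (hx : x ∈ reach (Metric.ball 0 (rad N))) :
    ∑ k ∈ Finset.Icc (-(n : ℤ)) n, M α k x = ∑ k ∈ Finset.Icc (-(N : ℤ)) N, M α k x +
      ∑ k ∈ Finset.Icc (-(n : ℤ)) n, tailTerm α N k (logCover x) := by
  have h1 := sum_branchTerm_eq h α (logCover x)
  have hsub : Finset.Icc (-(N : ℤ)) N ⊆ Finset.Icc (-(n : ℤ)) n :=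
    Finset.Icc_subset_Icc (by omega) (by omega)
  rw [← Finset.sum_sdiff hsub, add_comm] at h1 ⊢
  have h2 : ∑ k ∈ Finset.Icc (-(n : ℤ)) n \ Finset.Icc (-(N : ℤ)) N, M α k x =
      ∑ k ∈ Finset.Icc (-(n : ℤ)) n \ Finset.Icc (-(N : ℤ)) N, branchTerm α k (logCover x) := by
    refine Finset.sum_congr rfl fun k hk ↦ M_eq_branchTerm α (fun w hw ↦ ?_) hx
    rw [Finset.mem_sdiff, Finset.mem_Icc, Finset.mem_Icc, ← abs_le, ← abs_le] at hk
    exact neg_add_mem_slitPlane_of_mem_ball (not_le.mp hk.2) hw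
  rw [h2]
  congr 1
  exact add_left_cancel h1

/-- `R N` extends `Li_α (e^w) - ∑_{|k| ≤ N} C_α (w + 2πik)^{α-1}` to the disc of radius `rad N`. -/
structure IsRemainder (α : ℂ) (R : ℕ → ℂ → ℂ) : Prop where
  differentiableOn : ∀ N, DifferentiableOn ℂ (R N) (Metric.ball 0 (rad N))
  polylog_eq : ∀ N, ∀ w ∈ Metric.ball 0 (rad N), w.re < 0 → polylog α (Complex.exp w) =
    R N w + ∑ k ∈ Finset.Icc (-(N : ℤ)) N, branchTerm α k w

theorem exists_isRemainder {α : ℂ} (hα : ∀ n : ℤ, α ≠ n) : ∃ R, IsRemainder α R ∧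
    (α.re < 0 → ∀ N, R N = fun w ↦ ∑' k, tailTerm α N k w) := by
  obtain ⟨m, hm⟩ := exists_nat_gt α.re
  choose R h1 h2 h3 using exists_remainder m α hα hm
  exact ⟨R, ⟨h1, h2⟩, fun h N ↦ h3 N h⟩

/-- The remainders are compatible: on the smaller disc they differ by branch terms. -/
theorem IsRemainder.eq_add {α : ℂ} {R : ℕ → ℂ → ℂ} (hR : IsRemainder α R) {N n : ℕ} (h : N ≤ n)
    {w : ℂ} (hw : w ∈ Metric.ball 0 (rad N)) :
    R N w = R n w + ∑ k ∈ Finset.Icc (-(n : ℤ)) n, tailTerm α N k w := by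
  have hsub : Metric.ball (0 : ℂ) (rad N) ⊆ Metric.ball 0 (rad n) :=
    Metric.ball_subset_ball (rad_mono h)
  have hd : DifferentiableOn ℂ
      (fun w ↦ R n w + ∑ k ∈ Finset.Icc (-(n : ℤ)) n, tailTerm α N k w)
      (Metric.ball 0 (rad N)) := by
    refine ((hR.differentiableOn n).mono hsub).add (DifferentiableOn.fun_sum fun k _ v hv ↦ ?_)
    by_cases hk : |k| ≤ N
    · rw [show tailTerm α N k = fun _ ↦ 0 from funext fun w ↦ if_pos hk]
      exact differentiableWithinAt_const _
    · rw [show tailTerm α N k = branchTerm α k from funext fun w ↦ if_neg hk]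
      exact (differentiableAt_branchTerm α (neg_add_mem_slitPlane_of_mem_ball (not_le.mp hk)
        hv)).differentiableWithinAt
  have hp := neg_half_mem_ball N
  refine AnalyticOnNhd.eqOn_of_preconnected_of_eventuallyEq
    ((hR.differentiableOn N).analyticOnNhd Metric.isOpen_ball)
    (hd.analyticOnNhd Metric.isOpen_ball) (convex_ball _ _).isPreconnected hp ?_ hw
  filter_upwards [Metric.isOpen_ball.mem_nhds hp, isOpen_re_neg.mem_nhds
    (show (-(1 / 2) : ℂ) ∈ {w : ℂ | w.re < 0} by simp)] with v hv hv0
  have h1 := hR.polylog_eq N v hv hv0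
  rw [hR.polylog_eq n v (hsub hv) hv0, sum_branchTerm_eq h] at h1
  linear_combination -h1

/-- The analytic continuation of `Li_α`: remainder plus finitely many of the functions `M_α[k]`,
where the remainder belongs to a disc in which `log z` has been continued. -/
def polylogCover (α : ℂ) (R : ℕ → ℂ → ℂ) (x : Cover) : ℂ :=
  R (exists_mem_reach_rad x).choose (logCover x) +
    ∑ k ∈ Finset.Icc (-((exists_mem_reach_rad x).choose : ℤ)) (exists_mem_reach_rad x).choose,
      M α k x

theorem IsRemainder.polylogCover_eq {α : ℂ} {R : ℕ → ℂ → ℂ} (hR : IsRemainder α R) {N : ℕ}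
    {x : Cover} (hx : x ∈ reach (Metric.ball 0 (rad N))) : polylogCover α R x =
      R N (logCover x) + ∑ k ∈ Finset.Icc (-(N : ℤ)) N, M α k x := by
  have key : ∀ N n : ℕ, N ≤ n → x ∈ reach (Metric.ball 0 (rad N)) →
      R N (logCover x) + ∑ k ∈ Finset.Icc (-(N : ℤ)) N, M α k x =
        R n (logCover x) + ∑ k ∈ Finset.Icc (-(n : ℤ)) n, M α k x := fun N n h hx ↦ by
    rw [hR.eq_add h (logCover_mem_of_mem_reach hx), sum_M_eq α h hx]; ring
  rw [polylogCover, key _ _ (le_max_left _ N) (exists_mem_reach_rad x).choose_spec,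
    ← key _ _ (le_max_right _ N) hx]

theorem IsRemainder.isMultivaluedAnalytic {α : ℂ} {R : ℕ → ℂ → ℂ} (hR : IsRemainder α R) :
    IsMultivaluedAnalytic (polylogCover α R) := fun x ↦ by
  obtain ⟨N, hN⟩ := exists_mem_reach_rad x
  obtain ⟨r, hr, h⟩ := exists_sheet_subset_reach Metric.isOpen_ball hN
  obtain ⟨s, hs, -, hlog⟩ := exists_sheet_logCover x
  obtain ⟨f, hf, t, ht, hft⟩ := isMultivaluedAnalytic_sum_M α (Finset.Icc (-(N : ℤ)) N) x
  refine ⟨fun z ↦ R N (localLog x z) + f z, ?_, min r (min s t), lt_min hr (lt_min hs ht),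
    fun y hy ↦ ?_⟩
  · refine (AnalyticAt.comp (g := R N) (f := localLog x) ?_ (analyticAt_localLog x)).add hf
    rw [localLog_self]
    exact (hR.differentiableOn N).analyticOnNhd Metric.isOpen_ball _ (logCover_mem_of_mem_reach hN)
  · have hsum := hft y (Cover.sheet_mono _ ((min_le_right _ _).trans (min_le_right _ _)) hy)
    rw [hR.polylogCover_eq (h (Cover.sheet_mono _ (min_le_left _ _) hy)),
      hlog y (Cover.sheet_mono _ ((min_le_right _ _).trans (min_le_left _ _)) hy)]
    exact congrArg _ hsum

/-- Along paths in the punctured unit disc the continuation is given by the series. -/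
theorem IsRemainder.polylogCover_eq_polylog {α : ℂ} {R : ℕ → ℂ → ℂ} (hR : IsRemainder α R)
    {x : Cover} (hx : x ∈ reach {w | w.re < 0}) : polylogCover α R x = polylog α x.pt := by
  obtain ⟨N, hN⟩ := exists_mem_reach_rad x
  rw [hR.polylogCover_eq hN, ← exp_logCover, hR.polylog_eq N _ (logCover_mem_of_mem_reach hN)
    (logCover_mem_of_mem_reach hx)]
  congr 1
  exact Finset.sum_congr rfl fun k _ ↦
    M_eq_branchTerm α (fun w hw ↦ neg_add_mem_slitPlane hw k) hx

theorem exists_basePt_sheet_re_neg : ∃ r > (0 : ℝ), Cover.basePt.sheet r ⊆ reach {w | w.re < 0} :=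
  exists_sheet_subset_reach isOpen_re_neg
    (basePt_mem_reach (neg_neg_of_pos (Real.log_pos one_lt_two)))

theorem IsRemainder.isAnalyticContinuation {α : ℂ} {R : ℕ → ℂ → ℂ} (hR : IsRemainder α R) :
    IsAnalyticContinuation (polylog α) (polylogCover α R) := by
  obtain ⟨r, hr, h⟩ := exists_basePt_sheet_re_neg
  exact ⟨hR.isMultivaluedAnalytic, r, hr, fun y hy ↦ hR.polylogCover_eq_polylog (h hy)⟩

/-- `Li_α` is single-valued in the unit disc, so continuation along `loopZero` changes nothing. -/
theorem IsRemainder.polylogCover_act_loopZero {α : ℂ} {R : ℕ → ℂ → ℂ} (hR : IsRemainder α R)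
    (x : Cover) : polylogCover α R (x.act loopZero) = polylogCover α R x := by
  obtain ⟨r, hr, h⟩ := exists_basePt_sheet_re_neg
  refine congrFun ((hR.isMultivaluedAnalytic.act loopZero).eq_of_germ hR.isMultivaluedAnalytic hr
    fun y hy ↦ ?_) x
  have h1 := (act_mem_reach isLogAlong_loopZero logLoopZero_one logLoopZero_re
    (S := {w | w.re < 0}) (T := {w | w.re < 0}) (fun w hw ↦ ?_) (h hy)).1
  · rw [hR.polylogCover_eq_polylog (h hy), hR.polylogCover_eq_polylog h1]; rfl
  · have : (w + 2 * (Real.pi : ℂ) * Complex.I * ((1 : ℤ) : ℂ)).re = w.re := by simp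
    simpa [this] using hw

theorem IsRemainder.polylogCover_act_loopOne {α : ℂ} {R : ℕ → ℂ → ℂ} (hR : IsRemainder α R)
    (x : Cover) : polylogCover α R (x.act loopOne) = polylogCover α R x -
      (1 - Complex.exp (2 * (Real.pi : ℂ) * Complex.I * α)) * M α 0 x := by
  obtain ⟨N, hN⟩ := exists_mem_reach_rad x
  have hball : ∀ t, logLoopOne t ∈ Metric.ball 0 (rad N) := fun t ↦ by
    rw [mem_ball_zero_iff, rad]
    have : 0 ≤ 2 * Real.pi * N := by positivity
    linarith [norm_logLoopOne_le t]
  obtain ⟨h1, h2⟩ := act_mem_reach isLogAlong_loopOne (m := 0) (by rw [logLoopOne_one]; simp)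
    hball (fun w hw ↦ by simpa using hw) hN
  have h0 : (0 : ℤ) ∈ Finset.Icc (-(N : ℤ)) N := Finset.mem_Icc.mpr (by omega)
  rw [hR.polylogCover_eq hN, hR.polylogCover_eq h1, h2, ← Finset.add_sum_erase _ _ h0,
    ← Finset.add_sum_erase _ _ h0, M_zero_act_loopOne,
    Finset.sum_congr rfl fun k hk ↦ M_act_loopOne α (Finset.ne_of_mem_erase hk) x]
  simp only [Int.cast_zero, mul_zero, add_zero]
  ring

/-! ### Mittag-Leffler decomposition -/

theorem tendstoUniformlyOn_sum_branchTerm {α : ℂ} (hα : α.re < 0) {K : Set ℂ}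
    (hK : K ⊆ Metric.ball 0 1 \ {0}) :
    TendstoUniformlyOn (fun (N : ℕ) (z : ℂ) ↦ C α * ∑ k ∈ Finset.Icc (-(N : ℤ)) N,
        powPos (Complex.log z + 2 * (Real.pi : ℂ) * Complex.I * (k : ℂ)) (α - 1))
      (polylog α) atTop K := by
  have h := (tendstoUniformlyOn_tailTerm hα (N := 0) one_pos (S := {w | |w.im| ≤ Real.pi})
    fun w hw k _ ↦ le_norm_add_of_abs_im_le hw k).comp Complex.log
  rw [Metric.tendstoUniformlyOn_iff] at h ⊢
  intro ε hε
  filter_upwards [h ε hε] with n hn z hz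
  have hz1 := hK hz
  have hz0 : z ≠ 0 := hz1.2
  have hre : (Complex.log z).re < 0 := by
    rw [Complex.log_re]
    exact Real.log_neg (norm_pos_iff.mpr hz0) (mem_ball_zero_iff.mp hz1.1)
  have h2 := hn z (abs_le.mpr ⟨by rw [Complex.log_im]; exact (Complex.neg_pi_lt_arg z).le,
    Complex.log_im z ▸ Complex.arg_le_pi z⟩)
  rw [← Complex.exp_log hz0, polylog_exp_eq_tailTerm hα hre 0, Complex.exp_log hz0, Finset.mul_sum]
  have h3 := sum_branchTerm_eq (Nat.zero_le n) α (Complex.log z)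
  simp only [branchTerm] at h3 ⊢
  rw [h3, add_comm, dist_add_left]
  exact h2

theorem IsRemainder.tendstoUniformlyOn_sum_M {α : ℂ} {R : ℕ → ℂ → ℂ} (hR : IsRemainder α R)
    (hα : α.re < 0) (hRα : ∀ N, R N = fun w ↦ ∑' k, tailTerm α N k w) {K : Set Cover}
    (hK : IsCompact K) : TendstoUniformlyOn
      (fun (n : ℕ) x ↦ ∑ k ∈ Finset.Icc (-(n : ℤ)) n, M α k x) (polylogCover α R) atTop K := by
  obtain ⟨N, hN⟩ := hK.elim_directed_cover (fun N ↦ reach (Metric.ball 0 (rad N)))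
    (fun N ↦ isOpen_reach Metric.isOpen_ball)
    (fun x _ ↦ Set.mem_iUnion.mpr (exists_mem_reach_rad x))
    (Monotone.directed_le fun m n h ↦ reach_mono (Metric.ball_subset_ball (rad_mono h)))
  have h := (tendstoUniformlyOn_tailTerm hα (N := N) (inv_pos.mpr N.cast_add_one_pos)
    (S := Metric.ball 0 (rad N)) fun w hw k hk ↦ le_norm_add_of_mem_ball hw hk).comp logCover
  rw [Metric.tendstoUniformlyOn_iff] at h ⊢
  intro ε hε
  filter_upwards [h ε hε, eventually_ge_atTop N] with n hn hNn x hx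
  have h2 := hn x (logCover_mem_of_mem_reach (hN hx))
  rw [hR.polylogCover_eq (hN hx), sum_M_eq α hNn (hN hx), hRα, add_comm, dist_add_left]
  exact h2

/-! ### Appell's integral -/

theorem hasSum_geometric_exp {z q : ℂ} (h : ‖z‖ < Real.exp q.re) :
    HasSum (fun n : ℕ ↦ z ^ (n + 1) * Complex.exp (-(((n + 1 : ℕ) : ℝ) * q)))
      (z / (Complex.exp q - z)) := by
  have hx : ‖z * Complex.exp (-q)‖ < 1 := by
    rw [norm_mul, Complex.norm_exp, Complex.neg_re, Real.exp_neg, mul_inv_lt_iff₀ (Real.exp_pos _),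
      one_mul]
    exact h
  have h0 : Complex.exp q - z ≠ 0 := fun h0 ↦ by
    rw [← sub_eq_zero.mp h0, Complex.norm_exp] at h
    exact lt_irrefl _ h
  have h1 := (hasSum_geometric_of_norm_lt_one hx).mul_left (z * Complex.exp (-q))
  convert! h1 using 1
  · ext n
    rw [mul_comm (z * _), ← pow_succ, mul_pow, ← Complex.exp_nat_mul]
    push_cast
    congr 2; ring
  · rw [Complex.exp_neg]
    have := Complex.exp_ne_zero q
    have h2 : 1 - z * (Complex.exp q)⁻¹ ≠ 0 := by
      intro h3
      apply h0
      field_simp at h3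
      rw [h3, mul_zero]
    field_simp

theorem norm_geometric_le {z q : ℂ} {ρ : ℝ} (hρ : ρ < 1) (h : ‖z‖ * Real.exp (-q.re) ≤ ρ) :
    ‖z / (Complex.exp q - z)‖ ≤ ‖z‖ / (1 - ρ) * Real.exp (-q.re) := by
  have h1 : ‖z‖ ≤ ρ * Real.exp q.re := by
    rwa [Real.exp_neg, mul_inv_le_iff₀ (Real.exp_pos _)] at h
  have h2 : (1 - ρ) * Real.exp q.re ≤ ‖Complex.exp q - z‖ := by
    refine le_trans ?_ (norm_sub_norm_le _ _)
    rw [Complex.norm_exp]; linarith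
  have h3 : 0 < (1 - ρ) * Real.exp q.re := mul_pos (sub_pos.mpr hρ) (Real.exp_pos _)
  calc ‖z / (Complex.exp q - z)‖ ≤ ‖z‖ / ((1 - ρ) * Real.exp q.re) := by
        rw [norm_div]; gcongr
    _ = ‖z‖ / (1 - ρ) * Real.exp (-q.re) := by
        rw [Real.exp_neg, ← div_div, div_eq_mul_inv (_ / _)]

/-- Appell's integral: expand the geometric series and integrate term by term. -/
theorem polylog_eq_integral {α z : ℂ} (hα : 0 < α.re) (hz : ‖z‖ < 1) :
    IntegrableOn (fun q : ℝ ↦ (q : ℂ) ^ (α - 1) * (z / (Complex.exp (q : ℂ) - z)))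
        (Set.Ioi 0) ∧
      polylog α z = 1 / Complex.Gamma α *
        ∫ q in Set.Ioi (0 : ℝ), (q : ℂ) ^ (α - 1) * (z / (Complex.exp (q : ℂ) - z)) := by
  have hlt : ∀ q ∈ Set.Ioi (0 : ℝ), ‖z‖ < Real.exp (q : ℂ).re := fun q hq ↦
    hz.trans (Real.one_lt_exp_iff.mpr hq)
  constructor
  · have hmeas : ContinuousOn (fun q : ℝ ↦ (q : ℂ) ^ (α - 1) * (z / (Complex.exp (q : ℂ) - z)))
        (Set.Ioi 0) := by
      refine ContinuousOn.mul (fun x hx ↦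
        (Complex.continuousAt_ofReal_cpow_const x _ (.inr (ne_of_gt hx))).continuousWithinAt) ?_
      refine ContinuousOn.div (by fun_prop) (by fun_prop) fun q hq h0 ↦ ?_
      have := hlt q hq
      rw [← sub_eq_zero.mp h0, Complex.norm_exp] at this
      exact lt_irrefl _ this
    refine ((integrableOn_rpow_mul_exp (s := α.re - 1) (b := 1) (by linarith)
      one_pos).const_mul (‖z‖ / (1 - ‖z‖))).mono'
        (hmeas.aestronglyMeasurable measurableSet_Ioi) ?_
    filter_upwards [ae_restrict_mem measurableSet_Ioi] with q hq
    have h1 := norm_geometric_le (z := z) (q := (q : ℂ)) hz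
      (mul_le_of_le_one_right (norm_nonneg z) (Real.exp_le_one_iff.mpr
        (neg_nonpos.mpr (le_of_lt hq))))
    rw [norm_mul, Complex.norm_cpow_eq_rpow_re_of_pos hq, Complex.sub_re, Complex.one_re,
      mul_left_comm, neg_one_mul]
    exact mul_le_mul_of_nonneg_left h1 (Real.rpow_nonneg (le_of_lt hq) _)
  · have h := hasSum_mellin (a := fun n : ℕ ↦ z ^ (n + 1)) (p := fun n ↦ ((n + 1 : ℕ) : ℝ))
      (F := fun q : ℝ ↦ z / (Complex.exp (q : ℂ) - z)) (fun n ↦ .inr (by positivity)) hα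
      (fun t ht ↦ ?_) ?_
    · have h2 := h.tsum_eq
      simp_rw [mul_div_assoc, tsum_mul_left, Complex.ofReal_natCast] at h2
      rw [show mellin _ α = ∫ q in Set.Ioi (0 : ℝ), (q : ℂ) ^ (α - 1) *
        (z / (Complex.exp (q : ℂ) - z)) from rfl] at h2
      rw [← h2, polylog, one_div, inv_mul_cancel_left₀ (Complex.Gamma_ne_zero_of_re_pos hα)]
    · convert! hasSum_geometric_exp (hlt t ht) using 2 with n
      push_cast; ring_nf
    · refine (summable_geometric_mul_rpow (norm_nonneg z) hz (-α.re)).congr fun n ↦ ?_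
      rw [norm_pow, Real.rpow_neg (Nat.cast_nonneg _), div_eq_mul_inv]

/-! ### Integrals over Hankel contours -/

theorem powPos_end_isBigO (s : ℂ) {r : ℝ} (hr : 0 < r) (d : ℝ) :
    (fun t : ℝ ↦ powPos (t + d * Complex.I) s * Complex.exp (-(r * (t + d * Complex.I))))
      =O[atTop] fun t ↦ Real.exp (-(r / 2) * t) := by
  have h1 : (fun t : ℝ ↦ Real.exp (2 * Real.pi * |s.im|) * ((1 + 2 ^ s.re) * t ^ s.re) *
      Real.exp (-r * t)) =O[atTop] fun t ↦ Real.exp (r / 2 * t) * Real.exp (-r * t) :=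
    (((isLittleO_rpow_exp_pos_mul_atTop s.re (half_pos hr)).isBigO.const_mul_left _).const_mul_left
      _).mul (Asymptotics.isBigO_refl _ _)
  have h2 : (fun t : ℝ ↦ Real.exp (r / 2 * t) * Real.exp (-r * t)) =
      fun t ↦ Real.exp (-(r / 2) * t) := by
    ext t; rw [← Real.exp_add]; congr 1; ring
  rw [h2] at h1
  refine Asymptotics.IsBigO.trans (Asymptotics.IsBigO.of_bound 1 ?_) h1
  filter_upwards [eventually_gt_atTop 0, eventually_ge_atTop |d|] with t ht htd
  have hre : ((t : ℂ) + d * Complex.I).re = t := by simp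
  have hq0 : (t : ℂ) + d * Complex.I ≠ 0 := fun h ↦ by rw [h] at hre; simp at hre; linarith
  have hq1 : t ≤ ‖(t : ℂ) + d * Complex.I‖ := by
    simpa [hre, abs_of_pos ht] using Complex.abs_re_le_norm ((t : ℂ) + d * Complex.I)
  have hq2 : ‖(t : ℂ) + d * Complex.I‖ ≤ 2 * t := by
    refine (norm_add_le _ _).trans ?_
    rw [norm_mul, Complex.norm_I, Complex.norm_real, Complex.norm_real, Real.norm_eq_abs,
      Real.norm_eq_abs, abs_of_pos ht]
    linarith
  have hpow : ‖(t : ℂ) + d * Complex.I‖ ^ s.re ≤ (1 + 2 ^ s.re) * t ^ s.re := by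
    have ha : 0 ≤ t ^ s.re := Real.rpow_nonneg ht.le _
    have hb : 0 ≤ (2 : ℝ) ^ s.re * t ^ s.re := by positivity
    rcases le_total 0 s.re with hs | hs
    · have := Real.rpow_le_rpow (norm_nonneg _) hq2 hs
      rw [Real.mul_rpow zero_le_two ht.le] at this
      linarith
    · have := Real.rpow_le_rpow_of_nonpos ht hq1 hs
      linarith
  rw [norm_mul, Complex.norm_exp, one_mul, Real.norm_of_nonneg (by positivity)]
  have hexp : (-(r * ((t : ℂ) + d * Complex.I))).re = -r * t := by simp
  rw [hexp]
  gcongr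
  exact (norm_powPos_le hq0 s).trans (by gcongr)

namespace IsHankelContour

variable {γ : ℝ → ℂ}

theorem neg_mem_slitPlane (hγ : IsHankelContour γ) (t : ℝ) : -γ t ∈ Complex.slitPlane := by
  have := hγ.avoids t
  rw [Complex.mem_slitPlane_iff, Complex.neg_re, Complex.neg_im]
  by_contra! h
  exact this ⟨by linarith [h.1], by linarith [h.2]⟩

theorem hasDerivAt (hγ : IsHankelContour γ) (t : ℝ) : HasDerivAt γ (deriv γ t) t :=
  (hγ.contDiff.differentiable one_ne_zero t).hasDerivAt

theorem continuous_powPos (hγ : IsHankelContour γ) (s : ℂ) :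
    Continuous fun t ↦ powPos (γ t) s := by
  have hc := hγ.contDiff.continuous
  have : Continuous fun t ↦ logPos (γ t) :=
    (Continuous.clog (by fun_prop) hγ.neg_mem_slitPlane).add continuous_const
  unfold powPos
  fun_prop

theorem isBigO_atTop (hγ : IsHankelContour γ) (s : ℂ) {r : ℝ} (hr : 0 < r) :
    (fun t ↦ powPos (γ t) s * Complex.exp (-(r * γ t))) =O[atTop]
      fun t ↦ Real.exp (-(r / 2) * t) := by
  obtain ⟨δ, -, T, hT⟩ := hγ.upper
  refine (powPos_end_isBigO s hr δ).congr' ?_ EventuallyEq.rfl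
  filter_upwards [eventually_ge_atTop T] with t ht
  rw [hT t ht]

theorem isBigO_atBot (hγ : IsHankelContour γ) (s : ℂ) {r : ℝ} (hr : 0 < r) :
    (fun t ↦ powPos (γ t) s * Complex.exp (-(r * γ t))) =O[atBot]
      fun t ↦ Real.exp (-(r / 2) * -t) := by
  obtain ⟨δ, -, T, hT⟩ := hγ.lower
  refine ((powPos_end_isBigO s hr (-δ)).comp_tendsto tendsto_neg_atBot_atTop).congr' ?_
    EventuallyEq.rfl
  filter_upwards [eventually_le_atBot T] with t ht
  simp only [Function.comp_apply]
  rw [hT t ht, Complex.ofReal_neg δ, neg_mul, ← sub_eq_add_neg]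

theorem eventually_deriv_atTop (hγ : IsHankelContour γ) : ∀ᶠ t in atTop, deriv γ t = 1 := by
  obtain ⟨δ, -, T, hT⟩ := hγ.upper
  filter_upwards [eventually_gt_atTop T] with t ht
  have : γ =ᶠ[𝓝 t] fun t : ℝ ↦ (t : ℂ) + δ * Complex.I := by
    filter_upwards [lt_mem_nhds ht] with u hu using hT u hu.le
  rw [this.deriv_eq]
  exact ((hasDerivAt_id t).ofReal_comp.add_const _).deriv

theorem eventually_deriv_atBot (hγ : IsHankelContour γ) : ∀ᶠ t in atBot, deriv γ t = -1 := by
  obtain ⟨δ, -, T, hT⟩ := hγ.lower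
  filter_upwards [eventually_lt_atBot T] with t ht
  have : γ =ᶠ[𝓝 t] fun t : ℝ ↦ ((-t : ℝ) : ℂ) - δ * Complex.I := by
    filter_upwards [gt_mem_nhds ht] with u hu using hT u hu.le
  rw [this.deriv_eq]
  simpa using ((hasDerivAt_neg t).ofReal_comp.sub_const ((δ : ℂ) * Complex.I)).deriv

theorem integrable (hγ : IsHankelContour γ) (s : ℂ) {r : ℝ} (hr : 0 < r) :
    Integrable fun t ↦ powPos (γ t) s * Complex.exp (-(r * γ t)) * deriv γ t := by
  have hc := hγ.contDiff.continuous
  have hd := hγ.contDiff.continuous_deriv le_rfl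
  have hp := hγ.continuous_powPos s
  have hcont : Continuous fun t ↦ powPos (γ t) s * Complex.exp (-(r * γ t)) * deriv γ t := by
    fun_prop
  refine hcont.locallyIntegrable.integrable_of_isBigO_atBot_atTop
    (g := fun t ↦ Real.exp (-(r / 2) * -t)) (g' := fun t ↦ Real.exp (-(r / 2) * t)) ?_ ?_ ?_ ?_
  · refine (hγ.isBigO_atBot s hr).neg_left.congr' ?_ EventuallyEq.rfl
    filter_upwards [hγ.eventually_deriv_atBot] with t ht
    rw [ht, mul_neg_one]
  · refine ⟨Set.Iic 0, Iic_mem_atBot 0, ?_⟩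
    simpa using integrableOn_exp_mul_Iic (half_pos hr) 0
  · refine (hγ.isBigO_atTop s hr).congr' ?_ EventuallyEq.rfl
    filter_upwards [hγ.eventually_deriv_atTop] with t ht
    rw [ht, mul_one]
  · exact ⟨Set.Ioi 0, Ioi_mem_atTop 0, integrableOn_exp_mul_Ioi (by linarith) 0⟩

/-- Integration by parts: the Hankel integral satisfies the functional equation of `Γ`. -/
theorem integral_add_one (hγ : IsHankelContour γ) (s : ℂ) {r : ℝ} (hr : 0 < r) :
    s * ∫ t, powPos (γ t) (s - 1) * Complex.exp (-(r * γ t)) * deriv γ t =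
      r * ∫ t, powPos (γ t) s * Complex.exp (-(r * γ t)) * deriv γ t := by
  have h1 := hγ.integrable (s - 1) hr
  have h2 := hγ.integrable s hr
  have hderiv : ∀ t, HasDerivAt (fun t ↦ powPos (γ t) s * Complex.exp (-(r * γ t)))
      (s * (powPos (γ t) (s - 1) * Complex.exp (-(r * γ t)) * deriv γ t) -
        r * (powPos (γ t) s * Complex.exp (-(r * γ t)) * deriv γ t)) t := fun t ↦ by
    have h3 := (hasDerivAt_powPos (hγ.neg_mem_slitPlane t) s).comp_of_eq t (hγ.hasDerivAt t) rfl
    have h4 : HasDerivAt (fun t ↦ Complex.exp (-(r * γ t)))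
        (Complex.exp (-(r * γ t)) * -(r * deriv γ t)) t :=
      ((hγ.hasDerivAt t).const_mul (r : ℂ)).neg.cexp
    convert! h3.mul h4 using 1
    simp only [Function.comp_apply]
    ring
  have hlim : Tendsto (fun t : ℝ ↦ Real.exp (-(r / 2) * t)) atTop (𝓝 0) :=
    Real.tendsto_exp_atBot.comp (tendsto_id.const_mul_atTop_of_neg (by linarith))
  have h5 := integral_of_hasDerivAt_of_tendsto hderiv
    ((h1.const_mul s).sub (h2.const_mul (r : ℂ)))
    ((hγ.isBigO_atBot s hr).trans_tendsto (hlim.comp tendsto_neg_atBot_atTop))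
    ((hγ.isBigO_atTop s hr).trans_tendsto hlim)
  rw [integral_sub (h1.const_mul s) (h2.const_mul (r : ℂ)), integral_const_mul,
    integral_const_mul, sub_zero, sub_eq_zero] at h5
  exact h5

end IsHankelContour

/-! ### The incomplete Gamma function -/

/-- The entire function `∫₀¹ x^{a-1} e^{-wx} dx`; the lower incomplete `Γ`-function is
`w^a` times it. -/
def lowerGamma (a w : ℂ) : ℂ :=
  ∫ x in Set.Ioc (0 : ℝ) 1, (x : ℂ) ^ (a - 1) * Complex.exp (-(w * x))

theorem integrableOn_rpow_mul_exp_Ioc {s : ℝ} (hs : -1 < s) (c : ℝ) :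
    IntegrableOn (fun x : ℝ ↦ x ^ s * Real.exp (c * x)) (Set.Ioc 0 1) :=
  (intervalIntegrable_iff_integrableOn_Ioc_of_le zero_le_one).mp
    ((intervalIntegral.intervalIntegrable_rpow' hs).mul_continuousOn (by fun_prop))

theorem aestronglyMeasurable_cpow (s : ℂ) :
    AEStronglyMeasurable (fun x : ℝ ↦ (x : ℂ) ^ s) (volume.restrict (Set.Ioi 0)) :=
  ContinuousOn.aestronglyMeasurable (fun x hx ↦
    (Complex.continuousAt_ofReal_cpow_const x _ (.inr (ne_of_gt hx))).continuousWithinAt)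
    measurableSet_Ioi

theorem integrableOn_cpow_mul_exp_Ioc {s : ℂ} (hs : -1 < s.re) (w : ℂ) :
    IntegrableOn (fun x : ℝ ↦ (x : ℂ) ^ s * Complex.exp (-(w * x))) (Set.Ioc 0 1) := by
  refine (integrableOn_rpow_mul_exp_Ioc hs (-w.re)).mono'
    (((aestronglyMeasurable_cpow s).mono_set Set.Ioc_subset_Ioi_self).mul (by fun_prop)) ?_
  filter_upwards [ae_restrict_mem measurableSet_Ioc] with x hx
  rw [norm_mul, Complex.norm_cpow_eq_rpow_re_of_pos hx.1, Complex.norm_exp, Complex.neg_re,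
    Complex.re_mul_ofReal, neg_mul]

/-- The differential equation of the incomplete `Γ`-function, by integration by parts. -/
theorem exists_hasDerivAt_lowerGamma {a : ℂ} (ha : 0 < a.re) (w : ℂ) :
    ∃ d, HasDerivAt (lowerGamma a) d w ∧ a * lowerGamma a w + w * d = Complex.exp (-w) := by
  have hnorm : ∀ x ∈ Set.Ioc (0 : ℝ) 1, ‖(x : ℂ) ^ (a - 1)‖ = x ^ (a.re - 1) := fun x hx ↦ by
    rw [Complex.norm_cpow_eq_rpow_re_of_pos hx.1]; simp
  have hx1 : ∀ x ∈ Set.Ioc (0 : ℝ) 1, x * x ^ (a.re - 1) = x ^ a.re := fun x hx ↦ by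
    rw [← Real.rpow_one_add' hx.1.le (by linarith), add_sub_cancel]
  have ha0 : a ≠ 0 := fun h ↦ by rw [h] at ha; simp at ha
  have hx2 : ∀ x ∈ Set.Ioc (0 : ℝ) 1, (x : ℂ) * (x : ℂ) ^ (a - 1) = (x : ℂ) ^ a := fun x hx ↦ by
    have : (x : ℂ) ≠ 0 := Complex.ofReal_ne_zero.mpr hx.1.ne'
    rw [Complex.cpow_sub _ _ this, Complex.cpow_one, mul_div_cancel₀ _ this]
  have h := hasDerivAt_integral_exp (φ := fun x : ℝ ↦ (x : ℂ) ^ (a - 1)) (S := Set.Ioc 0 1)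
    measurableSet_Ioc Set.Ioc_subset_Ioi_self
    ((aestronglyMeasurable_cpow _).mono_set Set.Ioc_subset_Ioi_self) (c := w.re - 1) (w₀ := w)
    (by linarith)
    ((integrableOn_rpow_mul_exp_Ioc (s := a.re - 1) (by linarith) (-(w.re - 1))).congr_fun
      (fun x hx ↦ by simp only [hnorm x hx]) measurableSet_Ioc)
    ((integrableOn_rpow_mul_exp_Ioc (s := a.re) (by linarith) (-(w.re - 1))).congr_fun
      (fun x hx ↦ by simp only [hnorm x hx, hx1 x hx]) measurableSet_Ioc)
  refine ⟨_, h, ?_⟩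
  have hint1 := (integrableOn_cpow_mul_exp_Ioc (s := a - 1) (by simpa using ha) w).const_mul a
  have hint2 := (integrableOn_cpow_mul_exp_Ioc (s := a) (by linarith) w).const_mul w
  have hftc := intervalIntegral.integral_eq_sub_of_hasDerivAt_of_le zero_le_one
    (f := fun x : ℝ ↦ (x : ℂ) ^ a * Complex.exp (-(w * x)))
    (f' := fun x : ℝ ↦ a * ((x : ℂ) ^ (a - 1) * Complex.exp (-(w * x))) -
      w * ((x : ℂ) ^ a * Complex.exp (-(w * x))))
    ((Complex.continuous_ofReal_cpow_const ha).mul (by fun_prop)).continuousOn (fun x hx ↦ ?_)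
    ((intervalIntegrable_iff_integrableOn_Ioc_of_le zero_le_one).mpr (hint1.sub hint2))
  · rw [intervalIntegral.integral_of_le zero_le_one, integral_sub hint1 hint2,
      integral_const_mul, integral_const_mul] at hftc
    have hcongr : ∫ x in Set.Ioc (0 : ℝ) 1, x * (x : ℂ) ^ (a - 1) * Complex.exp (-(w * x)) =
        ∫ x in Set.Ioc (0 : ℝ) 1, (x : ℂ) ^ a * Complex.exp (-(w * x)) :=
      setIntegral_congr_fun measurableSet_Ioc fun x hx ↦ by simp only [hx2 x hx]
    rw [integral_neg, mul_neg, ← sub_eq_add_neg, lowerGamma, hcongr, hftc]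
    simp [Complex.zero_cpow ha0]
  · have h1 : HasDerivAt (fun x : ℝ ↦ (x : ℂ) ^ a) (a * (x : ℂ) ^ (a - 1)) x :=
      hasDerivAt_ofReal_cpow_const hx.1.ne' ha0
    have h2 : HasDerivAt (fun x : ℝ ↦ Complex.exp (-(w * x)))
        (Complex.exp (-(w * x)) * -(w * 1)) x :=
      ((hasDerivAt_id x).ofReal_comp.const_mul w).neg.cexp
    convert! h1.mul h2 using 1
    ring

/-- On `ℂ ∖ [0, ∞)` the function `q^{a-1} e^{-rq}` has the primitive `q^a · lowerGamma a (rq)`. -/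
theorem hasDerivAt_powPos_mul_lowerGamma {a : ℂ} (ha : 0 < a.re) (r : ℝ) {q : ℂ}
    (hq : -q ∈ Complex.slitPlane) :
    HasDerivAt (fun q ↦ powPos q a * lowerGamma a (r * q))
      (powPos q (a - 1) * Complex.exp (-(r * q))) q := by
  obtain ⟨d, hd, hode⟩ := exists_hasDerivAt_lowerGamma ha (r * q)
  have h0 : q ≠ 0 := neg_ne_zero.mp (Complex.slitPlane_ne_zero hq)
  have h1 : HasDerivAt (fun q : ℂ ↦ lowerGamma a (r * q)) (d * (r * 1)) q :=
    HasDerivAt.comp q hd ((hasDerivAt_id q).const_mul (r : ℂ))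
  have h2 : powPos q a = q * powPos q (a - 1) := by
    rw [powPos, powPos, sub_mul, one_mul, Complex.exp_sub, exp_logPos h0, mul_div_cancel₀ _ h0]
  convert! (hasDerivAt_powPos hq a).mul h1 using 1
  rw [← hode, h2]; ring

theorem integrableOn_cpow_mul_exp_Ioi {s : ℂ} (hs : -1 < s.re) {w : ℂ} (hw : 0 < w.re) :
    IntegrableOn (fun x : ℝ ↦ (x : ℂ) ^ s * Complex.exp (-(w * x))) (Set.Ioi 0) := by
  refine (integrableOn_rpow_mul_exp hs hw).mono'
    ((aestronglyMeasurable_cpow s).mul (by fun_prop)) ?_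
  filter_upwards [ae_restrict_mem measurableSet_Ioi] with x hx
  rw [norm_mul, Complex.norm_cpow_eq_rpow_re_of_pos hx, Complex.norm_exp, Complex.neg_re,
    Complex.re_mul_ofReal, neg_mul]

theorem logPos_of_im_pos {q : ℂ} (hq : 0 < q.im) : logPos q = Complex.log q := by
  apply Complex.ext
  · simp [logPos, Complex.log_re]
  · simp [logPos, Complex.log_im, Complex.arg_neg_eq_arg_sub_pi_of_im_pos hq]

theorem logPos_of_im_neg {q : ℂ} (hq : q.im < 0) :
    logPos q = Complex.log q + 2 * (Real.pi : ℂ) * Complex.I := by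
  apply Complex.ext
  · simp [logPos, Complex.log_re]
  · simp [logPos, Complex.log_im, Complex.arg_neg_eq_arg_add_pi_of_im_neg hq]
    ring

theorem powPos_of_im_pos {q : ℂ} (hq : 0 < q.im) (s : ℂ) : powPos q s = q ^ s := by
  have h0 : q ≠ 0 := fun h ↦ by rw [h] at hq; simp at hq
  rw [powPos, logPos_of_im_pos hq, Complex.cpow_def_of_ne_zero h0, mul_comm]

theorem powPos_of_im_neg {q : ℂ} (hq : q.im < 0) (s : ℂ) :
    powPos q s = Complex.exp (2 * (Real.pi : ℂ) * Complex.I * s) * q ^ s := by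
  have h0 : q ≠ 0 := fun h ↦ by rw [h] at hq; simp at hq
  rw [powPos, logPos_of_im_neg hq, Complex.cpow_def_of_ne_zero h0, ← Complex.exp_add]
  congr 1; ring

theorem cpow_end_isBigO (s : ℂ) {r : ℝ} (hr : 0 < r) {d : ℝ} (hd : d ≠ 0) :
    (fun t : ℝ ↦ ((t : ℂ) + d * Complex.I) ^ s * Complex.exp (-(r * (t + d * Complex.I))))
      =O[atTop] fun t ↦ Real.exp (-(r / 2) * t) := by
  have h := powPos_end_isBigO s hr d
  rcases hd.lt_or_gt with hd | hd
  · simp_rw [fun t : ℝ ↦ powPos_of_im_neg (q := (t : ℂ) + d * Complex.I) (by simpa using hd) s,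
      mul_assoc (Complex.exp (2 * (Real.pi : ℂ) * Complex.I * s))] at h
    exact (Asymptotics.isBigO_const_mul_left_iff (Complex.exp_ne_zero _)).mp h
  · simp_rw [fun t : ℝ ↦ powPos_of_im_pos (q := (t : ℂ) + d * Complex.I) (by simpa using hd) s] at h
    exact h

/-- Along a horizontal ray to `+∞`, the lower incomplete `Γ`-function tends to the complete one:
the missing part of Euler's integral, over `x > 1`, is exponentially small. -/
theorem tendsto_cpow_mul_lowerGamma {a : ℂ} (ha : 0 < a.re) {r : ℝ} (hr : 0 < r) {d : ℝ}
    (hd : d ≠ 0) :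
    Tendsto (fun t : ℝ ↦ ((t : ℂ) + d * Complex.I) ^ a * lowerGamma a (r * (t + d * Complex.I)))
      atTop (𝓝 ((r : ℂ) ^ (-a) * Complex.Gamma a)) := by
  let q : ℝ → ℂ := fun t ↦ (t : ℂ) + d * Complex.I
  have hre : ∀ t, (r * q t).re = r * t := fun t ↦ by simp [q]
  have ha' : -1 < (a - 1).re := by simpa using ha
  let U : ℝ → ℂ := fun t ↦
    ∫ x in Set.Ioi (1 : ℝ), (x : ℂ) ^ (a - 1) * Complex.exp (-(r * q t * x))
  have hint : IntegrableOn (fun x : ℝ ↦ x ^ (a.re - 1) * Real.exp (-r * x)) (Set.Ioi 1) :=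
    (integrableOn_rpow_mul_exp (by linarith) hr).mono_set (Set.Ioi_subset_Ioi zero_le_one)
  have hU : U =O[atTop] fun t ↦ Complex.exp (-(r * q t)) := by
    refine Asymptotics.IsBigO.of_bound
      (Real.exp r * ∫ x in Set.Ioi (1 : ℝ), x ^ (a.re - 1) * Real.exp (-r * x)) ?_
    filter_upwards [eventually_ge_atTop 1] with t ht
    rw [Complex.norm_exp, Complex.neg_re, hre, mul_right_comm, ← Real.exp_add,
      ← integral_const_mul]
    refine norm_integral_le_of_norm_le (hint.const_mul _) ?_
    filter_upwards [ae_restrict_mem measurableSet_Ioi] with x hx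
    have hx1 : (1 : ℝ) < x := hx
    have hx0 : 0 < x := one_pos.trans hx1
    rw [norm_mul, Complex.norm_cpow_eq_rpow_re_of_pos hx0, Complex.norm_exp, Complex.neg_re,
      Complex.re_mul_ofReal, hre, Complex.sub_re, Complex.one_re, mul_left_comm, ← Real.exp_add]
    refine mul_le_mul_of_nonneg_left (Real.exp_le_exp.mpr ?_) (Real.rpow_nonneg hx0.le _)
    -- `r (t - 1) (x - 1) ≥ 0`
    nlinarith [mul_nonneg (mul_nonneg hr.le (sub_nonneg.mpr ht)) (sub_nonneg.mpr hx1.le)]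
  have hlim : Tendsto (fun t : ℝ ↦ Real.exp (-(r / 2) * t)) atTop (𝓝 0) :=
    Real.tendsto_exp_atBot.comp (tendsto_id.const_mul_atTop_of_neg (by linarith))
  have h0 : Tendsto (fun t ↦ q t ^ a * U t) atTop (𝓝 0) :=
    (((Asymptotics.isBigO_refl (fun t ↦ q t ^ a) atTop).mul hU).trans
      (cpow_end_isBigO a hr hd)).trans_tendsto hlim
  have h1 := h0.const_sub ((r : ℂ) ^ (-a) * Complex.Gamma a)
  rw [sub_zero] at h1
  refine h1.congr' ?_
  filter_upwards [eventually_gt_atTop 0] with t ht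
  have hw : 0 < (r * q t).re := by rw [hre]; positivity
  have hq0 : q t ≠ 0 := fun h ↦ by rw [h] at hw; simp at hw
  have h2 := integrableOn_cpow_mul_exp_Ioi ha' hw
  have h3 := setIntegral_union (Set.Ioc_disjoint_Ioi_same (a := (0 : ℝ)) (b := 1))
    measurableSet_Ioi (h2.mono_set Set.Ioc_subset_Ioi_self)
    (h2.mono_set (Set.Ioi_subset_Ioi zero_le_one))
  rw [Set.Ioc_union_Ioi_eq_Ioi zero_le_one, integral_cpow_mul_exp_neg_mul_complex ha hw] at h3
  have h4 : q t ^ a * Complex.exp (-a * Complex.log (r * q t)) = (r : ℂ) ^ (-a) := by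
    rw [Complex.log_ofReal_mul hr hq0, Complex.cpow_def_of_ne_zero hq0,
      Complex.cpow_def_of_ne_zero (Complex.ofReal_ne_zero.mpr hr.ne'), ← Complex.exp_add,
      Complex.ofReal_log hr.le]
    congr 1; ring
  rw [← h4]
  simp only [lowerGamma, U] at h3 ⊢
  linear_combination (q t ^ a) * h3

/-! ### Hankel's formula -/

/-- Hankel's formula for `Re a > 0`, from the values of the primitive at the two ends. -/
theorem IsHankelContour.integral_eq_of_re_pos {γ : ℝ → ℂ} (hγ : IsHankelContour γ) {a : ℂ}
    (ha : 0 < a.re) {r : ℝ} (hr : 0 < r) :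
    ∫ t, powPos (γ t) (a - 1) * Complex.exp (-(r * γ t)) * deriv γ t =
      (1 - Complex.exp (2 * (Real.pi : ℂ) * Complex.I * a)) *
        ((r : ℂ) ^ (-a) * Complex.Gamma a) := by
  have hderiv : ∀ t, HasDerivAt (fun t ↦ powPos (γ t) a * lowerGamma a (r * γ t))
      (powPos (γ t) (a - 1) * Complex.exp (-(r * γ t)) * deriv γ t) t := fun t ↦
    (hasDerivAt_powPos_mul_lowerGamma ha r (hγ.neg_mem_slitPlane t)).comp_of_eq t
      (hγ.hasDerivAt t) rfl
  have htop : Tendsto (fun t ↦ powPos (γ t) a * lowerGamma a (r * γ t)) atTop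
      (𝓝 ((r : ℂ) ^ (-a) * Complex.Gamma a)) := by
    obtain ⟨δ, hδ, T, hT⟩ := hγ.upper
    refine (tendsto_cpow_mul_lowerGamma ha hr hδ.ne').congr' ?_
    filter_upwards [eventually_ge_atTop T] with t ht
    rw [hT t ht, powPos_of_im_pos (by simpa using hδ)]
  have hbot : Tendsto (fun t ↦ powPos (γ t) a * lowerGamma a (r * γ t)) atBot
      (𝓝 (Complex.exp (2 * (Real.pi : ℂ) * Complex.I * a) *
        ((r : ℂ) ^ (-a) * Complex.Gamma a))) := by
    obtain ⟨δ, hδ, T, hT⟩ := hγ.lower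
    refine (((tendsto_cpow_mul_lowerGamma ha hr (neg_ne_zero.mpr hδ.ne')).comp
      tendsto_neg_atBot_atTop).const_mul _).congr' ?_
    filter_upwards [eventually_le_atBot T] with t ht
    rw [hT t ht, powPos_of_im_neg (by simpa using hδ), mul_assoc]
    simp [sub_eq_add_neg, mul_assoc]
  rw [integral_of_hasDerivAt_of_tendsto hderiv (hγ.integrable (a - 1) hr) hbot htop]
  ring

/-- Hankel's formula. -/
theorem IsHankelContour.integral_eq {γ : ℝ → ℂ} (hγ : IsHankelContour γ) {r : ℝ} (hr : 0 < r)
    (m : ℕ) : ∀ a : ℂ, (∀ n : ℤ, a ≠ n) → -m < a.re →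
    ∫ t, powPos (γ t) (a - 1) * Complex.exp (-(r * γ t)) * deriv γ t =
      (1 - Complex.exp (2 * (Real.pi : ℂ) * Complex.I * a)) *
        ((r : ℂ) ^ (-a) * Complex.Gamma a) := by
  induction m with
  | zero => exact fun a _ ha ↦ hγ.integral_eq_of_re_pos (by simpa using ha) hr
  | succ m ih =>
    intro a ha hm
    have ha0 : a ≠ 0 := by simpa using ha 0
    have h1 := ih (a + 1) (fun n h ↦ ha (n - 1) (by push_cast; rw [← h]; ring))
      (by rw [Complex.add_re, Complex.one_re]; push_cast at hm; linarith)
    have h2 := hγ.integral_add_one a hr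
    have hr0 : (r : ℂ) ≠ 0 := Complex.ofReal_ne_zero.mpr hr.ne'
    rw [add_sub_cancel_right, Complex.Gamma_add_one a ha0, mul_add, mul_one, Complex.exp_add,
      Complex.exp_two_pi_mul_I, mul_one, neg_add, Complex.cpow_add _ _ hr0,
      Complex.cpow_neg_one] at h1
    rw [h1] at h2
    refine mul_left_cancel₀ ha0 (h2.trans ?_)
    field_simp

/-- The constant `C_α` normalizes Hankel's integral, by the reflection formula. -/
theorem C_mul_Gamma {α : ℂ} (hα : ∀ n : ℤ, α ≠ n) :
    C α * ((1 - Complex.exp (2 * (Real.pi : ℂ) * Complex.I * α)) * Complex.Gamma α) =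
      2 * (Real.pi : ℂ) * Complex.I := by
  have hsin : Complex.sin (Real.pi * α) ≠ 0 := fun h ↦ by
    obtain ⟨k, hk⟩ := Complex.sin_eq_zero_iff.mp h
    refine hα k (mul_left_cancel₀ (Complex.ofReal_ne_zero.mpr Real.pi_ne_zero) ?_)
    rw [hk, mul_comm]
  have h1 := Complex.Gamma_mul_Gamma_one_sub α
  have h2 : Complex.exp ((Real.pi : ℂ) * Complex.I * (-α - 1)) *
      (1 - Complex.exp (2 * (Real.pi : ℂ) * Complex.I * α)) =
        2 * Complex.I * Complex.sin (Real.pi * α) := by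
    rw [mul_sub, mul_one, ← Complex.exp_add, Complex.sin,
      show (Real.pi : ℂ) * Complex.I * (-α - 1) =
        -(Real.pi * α) * Complex.I - (Real.pi : ℂ) * Complex.I by ring,
      show -(Real.pi * α) * Complex.I - (Real.pi : ℂ) * Complex.I +
        2 * (Real.pi : ℂ) * Complex.I * α =
          Real.pi * α * Complex.I - (Real.pi : ℂ) * Complex.I by ring,
      Complex.exp_sub, Complex.exp_sub, Complex.exp_pi_mul_I]
    linear_combination -(Complex.exp (-(Real.pi * α) * Complex.I) -
      Complex.exp (Real.pi * α * Complex.I)) * Complex.I_mul_I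
  calc C α * ((1 - Complex.exp (2 * (Real.pi : ℂ) * Complex.I * α)) * Complex.Gamma α)
      = (Complex.exp ((Real.pi : ℂ) * Complex.I * (-α - 1)) *
          (1 - Complex.exp (2 * (Real.pi : ℂ) * Complex.I * α))) *
          (Complex.Gamma α * Complex.Gamma (1 - α)) := by rw [C]; ring
    _ = 2 * (Real.pi : ℂ) * Complex.I := by rw [h1, h2]; field_simp

/-- The ratio `|z e^{-q}|` of the geometric series stays away from `1` along the contour, because
`Re q` attains its minimum there. -/
theorem IsHankelContour.exists_ratio_lt_one {γ : ℝ → ℂ} (hγ : IsHankelContour γ) {z : ℂ}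
    (h : ∀ t, ‖z‖ < Real.exp (γ t).re) :
    ∃ ρ < 1, 0 ≤ ρ ∧ ∀ t, ‖z‖ * Real.exp (-(γ t).re) ≤ ρ := by
  have hlim : Tendsto (fun t ↦ (γ t).re) (cocompact ℝ) atTop := by
    rw [cocompact_eq_atBot_atTop, tendsto_sup]
    constructor
    · obtain ⟨δ, -, T, hT⟩ := hγ.lower
      refine tendsto_neg_atBot_atTop.congr' ?_
      filter_upwards [eventually_le_atBot T] with t ht
      rw [hT t ht]; simp
    · obtain ⟨δ, -, T, hT⟩ := hγ.upper
      refine tendsto_id.congr' ?_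
      filter_upwards [eventually_ge_atTop T] with t ht
      rw [hT t ht]; simp
  obtain ⟨t₀, ht₀⟩ :=
    (Complex.continuous_re.comp hγ.contDiff.continuous).exists_forall_le hlim
  refine ⟨‖z‖ * Real.exp (-(γ t₀).re), ?_, by positivity, fun t ↦ ?_⟩
  · rw [Real.exp_neg, mul_inv_lt_iff₀ (Real.exp_pos _), one_mul]
    exact h t₀
  · exact mul_le_mul_of_nonneg_left (Real.exp_le_exp.mpr (neg_le_neg (ht₀ t))) (norm_nonneg _)

/-- The Hankel integral for `Li_α`: expand the geometric series and integrate term by term. -/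
theorem IsHankelContour.polylog_eq {γ : ℝ → ℂ} (hγ : IsHankelContour γ) {α z : ℂ}
    (hα : ∀ n : ℤ, α ≠ n) (h : ∀ t, ‖z‖ < Real.exp (γ t).re) :
    Integrable (fun t : ℝ ↦
        powPos (γ t) (α - 1) * (z / (Complex.exp (γ t) - z)) * deriv γ t) ∧
      polylog α z = C α / (2 * (Real.pi : ℂ) * Complex.I) *
        ∫ t : ℝ, powPos (γ t) (α - 1) * (z / (Complex.exp (γ t) - z)) * deriv γ t := by
  obtain ⟨ρ, hρ, hρ0, hle⟩ := hγ.exists_ratio_lt_one h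
  have hg := (hγ.integrable (α - 1) one_pos).norm
  have hnorm : ∀ t, ‖powPos (γ t) (α - 1) * Complex.exp (-(((1 : ℝ) : ℂ) * γ t)) * deriv γ t‖ =
      ‖powPos (γ t) (α - 1)‖ * Real.exp (-(γ t).re) * ‖deriv γ t‖ := fun t ↦ by
    simp [Complex.norm_exp]
  simp_rw [hnorm] at hg
  have hc := hγ.contDiff.continuous
  have hd := hγ.contDiff.continuous_deriv le_rfl
  have hp := hγ.continuous_powPos (α - 1)
  constructor
  · have hcont : Continuous fun t ↦
        powPos (γ t) (α - 1) * (z / (Complex.exp (γ t) - z)) * deriv γ t := by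
      refine (hp.mul (continuous_const.div (by fun_prop) fun t h0 ↦ ?_)).mul hd
      have := h t
      rw [← sub_eq_zero.mp h0, Complex.norm_exp] at this
      exact lt_irrefl _ this
    refine (hg.const_mul (‖z‖ / (1 - ρ))).mono' hcont.aestronglyMeasurable (.of_forall fun t ↦ ?_)
    rw [norm_mul, norm_mul]
    calc _ ≤ ‖powPos (γ t) (α - 1)‖ * (‖z‖ / (1 - ρ) * Real.exp (-(γ t).re)) * ‖deriv γ t‖ := by
          gcongr
          exact norm_geometric_le hρ (hle t)
      _ = _ := by ring
  · have hint : ∀ n : ℕ, Integrable fun t ↦ z ^ (n + 1) * (powPos (γ t) (α - 1) *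
        Complex.exp (-(((n + 1 : ℕ) : ℝ) * γ t)) * deriv γ t) := fun n ↦
      (hγ.integrable (α - 1) (r := ((n + 1 : ℕ) : ℝ)) (by positivity)).const_mul _
    have hbound : ∀ (n : ℕ) t, ‖z ^ (n + 1) * (powPos (γ t) (α - 1) *
        Complex.exp (-(((n + 1 : ℕ) : ℝ) * γ t)) * deriv γ t)‖ ≤ ρ ^ n * (‖z‖ *
          (‖powPos (γ t) (α - 1)‖ * Real.exp (-(γ t).re) * ‖deriv γ t‖)) := fun n t ↦ by
      have h1 : ‖Complex.exp (-(((n + 1 : ℕ) : ℝ) * γ t))‖ = Real.exp (-(γ t).re) ^ (n + 1) := by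
        rw [Complex.norm_exp, ← Real.exp_nat_mul]
        congr 1
        rw [Complex.neg_re, Complex.re_ofReal_mul]; ring
      rw [norm_mul, norm_mul, norm_mul, norm_pow, h1]
      calc _ = (‖z‖ * Real.exp (-(γ t).re)) ^ n * (‖z‖ *
          (‖powPos (γ t) (α - 1)‖ * Real.exp (-(γ t).re) * ‖deriv γ t‖)) := by ring
        _ ≤ _ := by gcongr; exact hle t
    have hsum : Summable fun n : ℕ ↦ ∫ t, ‖z ^ (n + 1) * (powPos (γ t) (α - 1) *
        Complex.exp (-(((n + 1 : ℕ) : ℝ) * γ t)) * deriv γ t)‖ := by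
      refine ((summable_geometric_of_lt_one hρ0 hρ).mul_right _).of_nonneg_of_le
        (fun n ↦ integral_nonneg fun t ↦ norm_nonneg _) fun n ↦
          (integral_mono (hint n).norm ((hg.const_mul ‖z‖).const_mul (ρ ^ n)) (hbound n)).trans_eq
            (integral_const_mul _ _)
    have key := hasSum_integral_of_summable_integral_norm hint hsum
    have h2 : ∀ t, ∑' n : ℕ, z ^ (n + 1) * (powPos (γ t) (α - 1) *
        Complex.exp (-(((n + 1 : ℕ) : ℝ) * γ t)) * deriv γ t) =
          powPos (γ t) (α - 1) * (z / (Complex.exp (γ t) - z)) * deriv γ t := fun t ↦ by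
      rw [← (((hasSum_geometric_exp (h t)).mul_left (powPos (γ t) (α - 1))).mul_right
        (deriv γ t)).tsum_eq]
      exact tsum_congr fun n ↦ by ring
    simp_rw [h2] at key
    obtain ⟨m, hm⟩ := exists_nat_gt (-α.re)
    have h3 : ∀ n : ℕ, ∫ t, z ^ (n + 1) * (powPos (γ t) (α - 1) *
        Complex.exp (-(((n + 1 : ℕ) : ℝ) * γ t)) * deriv γ t) =
          ((1 - Complex.exp (2 * (Real.pi : ℂ) * Complex.I * α)) * Complex.Gamma α) *
            (z ^ (n + 1) / ((n + 1 : ℕ) : ℂ) ^ α) := fun n ↦ by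
      have h4 := hγ.integral_eq (r := ((n + 1 : ℕ) : ℝ)) (by positivity) m α hα (by linarith)
      rw [integral_const_mul, h4, Complex.ofReal_natCast, Complex.cpow_neg]
      ring
    have h5 := key.tsum_eq
    simp_rw [h3] at h5
    rw [tsum_mul_left] at h5
    rw [← h5, polylog, ← mul_assoc, div_mul_eq_mul_div, C_mul_Gamma hα, div_self, one_mul]
    exact Complex.two_pi_I_ne_zero

end FracPolylog

end

theorem theorem1 :
    -- (a) Appell's integral
    (∀ α z : ℂ, 0 < α.re → ‖z‖ < 1 →
      IntegrableOn (fun q : ℝ ↦ (q : ℂ) ^ (α - 1) * (z / (Complex.exp (q : ℂ) - z)))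
        (Set.Ioi 0) ∧
      polylog α z = 1 / Complex.Gamma α *
        ∫ q in Set.Ioi (0 : ℝ), (q : ℂ) ^ (α - 1) * (z / (Complex.exp (q : ℂ) - z))) ∧
    -- (b) the integral over a Hankel contour that leaves the poles `log z + 2πik` on its left
    (∀ α z : ℂ, (∀ n : ℤ, α ≠ n) → ‖z‖ < 1 →
      ∀ γ : ℝ → ℂ, IsHankelContour γ → (∀ t, ‖z‖ < Real.exp (γ t).re) →
        Integrable (fun t : ℝ ↦
          powPos (γ t) (α - 1) * (z / (Complex.exp (γ t) - z)) * deriv γ t) ∧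
        polylog α z = C α / (2 * (Real.pi : ℂ) * Complex.I) *
          ∫ t : ℝ, powPos (γ t) (α - 1) * (z / (Complex.exp (γ t) - z)) * deriv γ t) ∧
    -- (c) analytic continuation and monodromy
    (∀ α : ℂ, (∀ n : ℤ, α ≠ n) →
      (∃! L : Cover → ℂ, IsAnalyticContinuation (polylog α) L) ∧
      (∀ k : ℤ, IsAnalyticContinuation
        (fun z ↦ C α * powPos (Complex.log z + 2 * (Real.pi : ℂ) * Complex.I * (k : ℂ)) (α - 1))
        (M α k)) ∧
      ∀ L : Cover → ℂ, IsAnalyticContinuation (polylog α) L → ∀ x : Cover,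
        L (x.act loopZero) = L x ∧
        L (x.act loopOne) =
          L x - (1 - Complex.exp (2 * (Real.pi : ℂ) * Complex.I * α)) * M α 0 x ∧
        M α 0 (x.act loopZero) = M α 1 x ∧
        M α 0 (x.act loopOne) =
          M α 0 x - (1 - Complex.exp (2 * (Real.pi : ℂ) * Complex.I * α)) * M α 0 x) ∧
    -- (d) Mittag-Leffler decomposition, in the unit disc and on the universal cover
    (∀ α : ℂ, (∀ n : ℤ, α ≠ n) → α.re < 0 →
      (∀ K : Set ℂ, IsCompact K → K ⊆ Metric.ball 0 1 \ {0} →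
        TendstoUniformlyOn
          (fun (N : ℕ) (z : ℂ) ↦ C α * ∑ k ∈ Finset.Icc (-(N : ℤ)) N,
            powPos (Complex.log z + 2 * (Real.pi : ℂ) * Complex.I * (k : ℂ)) (α - 1))
          (polylog α) atTop K) ∧
      ∀ L : Cover → ℂ, IsAnalyticContinuation (polylog α) L →
        ∀ K : Set Cover, IsCompact K →
          TendstoUniformlyOn
            (fun (N : ℕ) (x : Cover) ↦ ∑ k ∈ Finset.Icc (-(N : ℤ)) N, M α k x)
            L atTop K) := by
  refine ⟨fun α z hα hz ↦ polylog_eq_integral hα hz,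
    fun α z hα _ γ hγ h ↦ hγ.polylog_eq hα h, fun α hα ↦ ?_, fun α hα hre ↦
      ⟨fun K _ hK ↦ tendstoUniformlyOn_sum_branchTerm hre hK, fun L hL K hK ↦ ?_⟩⟩
  · obtain ⟨R, hR, -⟩ := exists_isRemainder hα
    have hR' := hR.isAnalyticContinuation
    refine ⟨⟨_, hR', fun L hL ↦ hL.unique hR'⟩, isAnalyticContinuation_M α, fun L hL x ↦ ?_⟩
    rw [hL.unique hR']
    refine ⟨hR.polylogCover_act_loopZero x, hR.polylogCover_act_loopOne x, M_act_loopZero α 0 x, ?_⟩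
    rw [M_zero_act_loopOne]
    ring
  · obtain ⟨R, hR, hRα⟩ := exists_isRemainder hα
    rw [hL.unique hR.isAnalyticContinuation]
    exact hR.tendstoUniformlyOn_sum_M hre (hRα hre) hK
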